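/- Let $\mathbb D\subset\mathbb C$ be the open unit disk, $dv$ Lebesgue measure, and let $B(w,\eta)$ be the Bergman kernel of $\mathbb D$, i.e. the reproducing kernel of the space $A^2(\mathbb D)$ of square-integrable holomorphic functions on $\mathbb D$: for every $w\in\mathbb D$, $\overline{B(w,\cdot)}\in A^2(\mathbb D)$ and $f(w)=\int_{\mathbb D}B(w,\eta)f(\eta)\,dv(\eta)$ for all $f\in A^2(\mathbb D)$. Let $$\mathcal B^+_{\mathbb D}(f)(w)=\int_{\mathbb D}|B(w,\eta)|\,f(\eta)\,dv(\eta),\qquad w\in\mathbb D .$$ For $w_2\in\mathbb D$ let $L^p(\mathbb D,|w_1-w_2|^2)$ be the space of (classes of) measurable functions $f:\mathbb D\to\mathbb C$ with $\int_{\mathbb D}|f(w_1)|^p|w_1-w_2|^2\,dv(w_1)<\infty$, with the corresponding norm. Let $2<p<\infty$. Then for every $w_2\in\mathbb D$ the integral defining $\mathcal B^+_{\mathbb D}(f)(w)$ converges absolutely for all $f\in L^p(\mathbb D,|w_1-w_2|^2)$ and all $w\in\mathbb D$, and $\mathcal B^+_{\mathbb D}$ is a bounded linear operator from $L^p(\mathbb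 D,|w_1-w_2|^2)$ to itself. Moreover, its operator norm is bounded by a constant that depends only on $p$ and not on $w_2$. -/

import Mathlib

open MeasureTheory Set
open scoped ENNReal ComplexConjugate

/-- The open unit disk `𝔻` in the complex plane. -/
def unitDisk : Set ℂ := Metric.ball 0 1

/-- Membership in the Bergman space `A²(Ω)`: holomorphic on `Ω` and square integrable on `Ω` with
respect to Lebesgue measure. Values of `f` off `Ω` are irrelevant. -/
def MemBergmanSpace (Ω : Set ℂ) (f : ℂ → ℂ) : Prop :=
  DifferentiableOn ℂ f Ω ∧ MemLp f 2 (volume.restrict Ω)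

/-- `K` is a Bergman kernel of `Ω`: for every `w ∈ Ω`, the function `η ↦ conj (K w η)` lies in
`A²(Ω)` and integration against `K w` reproduces the value at `w` of every function in `A²(Ω)`.
These properties determine `K` on `Ω × Ω` when `Ω` is open. -/
def IsBergmanKernel (Ω : Set ℂ) (K : ℂ → ℂ → ℂ) : Prop :=
  ∀ w ∈ Ω, MemBergmanSpace Ω (fun η => conj (K w η)) ∧
    ∀ f : ℂ → ℂ, MemBergmanSpace Ω f → f w = ∫ η in Ω, K w η * f η

/-- The Bergman kernel `B(w, η)` of `Ω`, the reproducing kernel of `A²(Ω)`. It exists for every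
open `Ω` and is unique on `Ω × Ω`; its values elsewhere are unspecified and never used. -/
noncomputable def bergmanKernel (Ω : Set ℂ) : ℂ → ℂ → ℂ :=
  Classical.epsilon (IsBergmanKernel Ω)

/-- The positive Bergman operator
`(B⁺_Ω f)(w) = ∫_Ω |B(w, η)| f(η) dv(η)`, for `w ∈ Ω`. -/
noncomputable def positiveBergman (Ω : Set ℂ) (f : ℂ → ℂ) (w : ℂ) : ℂ :=
  ∫ η in Ω, (‖bergmanKernel Ω w η‖ : ℂ) * f η

/-- The measure `|w₁ - w₂|² dv(w₁)` on the unit disk, for a fixed `w₂`. -/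
noncomputable def weightedDiskMeasure (w₂ : ℂ) : Measure ℂ :=
  (volume.restrict unitDisk).withDensity (fun w₁ => ENNReal.ofReal (‖w₁ - w₂‖ ^ 2))

/-! The Bergman kernel of the disk is `π⁻¹ (1 - w conj η)⁻²`, so the operator has kernel `|1 - w
conj η|⁻²` up to a constant, and boundedness follows from Schur's test (`schur_test`) with the test
function `H(η) = (1 - |η|)^(-σ) |η - a|^(-τ)`, where `a = w₂`, `τ = 2/(p - 1)` and `σ` is small.

With this `τ`, `H^(p-1)` times the weight `|η - a|²` is `(1 - |η|)^(-σ(p-1))`. The point `a`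
disappears, and the second Schur condition is the classical estimate `forelli_rudin`.

The first condition, `∫ |1 - w conj η|⁻² H(η) ≤ C H(w)` with `C` independent of `a`, is
`lintegral_schur_weight_le`. The assumption `p > 2` enters as `τ < 2`, which makes `|η - a|^(-τ)`
locally integrable in the plane. If `η` is not much closer to `a` than `|1 - w conj η|`, then `|w -
a|` is at most a multiple of `|η - a|` and Forelli–Rudin suffices. Otherwise Young's inequality
separates the two singular factors: one term is again Forelli–Rudin, with exponent `σq < 1`, and the
other is the integral of `|η - a|^(-t)`, `τ < t < 2`, over a disk about `a` whose radius is
comparable to `|1 - w conj η|`. Scaling makes its contribution a constant.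

Absolute convergence at every single `w` comes from the same Hölder splitting, because for fixed `w`
the kernel is bounded. -/

/-! ### Polar coordinates on disks. -/

theorem polarCoord_symm_eq_circleMap (p : ℝ × ℝ) :
    Complex.polarCoord.symm p = circleMap 0 p.1 p.2 := by
  simp [circleMap, Complex.exp_mul_I]

/-- Integration over a disk in polar coordinates, for nonnegative functions. -/
theorem lintegral_ball_polar {f : ℂ → ℝ≥0∞} (hf : Measurable f) (N : ℝ) :
    ∫⁻ z in Metric.ball 0 N, f z =
      ∫⁻ r in Ioo 0 N, ENNReal.ofReal r * ∫⁻ θ in Ioo (-Real.pi) Real.pi, f (circleMap 0 r θ) := by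
  have hcm : Measurable fun p : ℝ × ℝ => circleMap 0 p.1 p.2 := by
    unfold circleMap; fun_prop
  rw [← lintegral_indicator Metric.isOpen_ball.measurableSet,
    ← Complex.lintegral_comp_polarCoord_symm, polarCoord_target, Measure.volume_eq_prod,
    ← Measure.prod_restrict]
  simp_rw [polarCoord_symm_eq_circleMap, smul_eq_mul]
  rw [lintegral_prod _ (by
    refine Measurable.aemeasurable ?_
    exact (ENNReal.measurable_ofReal.comp measurable_fst).mul
      ((hf.indicator Metric.isOpen_ball.measurableSet).comp hcm))]
  have : ∀ r ∈ Ioi (0 : ℝ), (∫⁻ θ in Ioo (-Real.pi) Real.pi,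
      ENNReal.ofReal r * (Metric.ball 0 N).indicator f (circleMap 0 r θ)) =
      (Iio N).indicator (fun r => ENNReal.ofReal r *
        ∫⁻ θ in Ioo (-Real.pi) Real.pi, f (circleMap 0 r θ)) r := by
    intro r hr
    have hr' : |r| = r := abs_of_pos hr
    by_cases hN : r < N
    · have hcr : Measurable (circleMap 0 r) := (continuous_circleMap 0 r).measurable
      have hfr : Measurable fun θ => (Metric.ball 0 N).indicator f (circleMap 0 r θ) :=
        (hf.indicator Metric.isOpen_ball.measurableSet).comp hcr
      rw [indicator_of_mem (by exact hN), lintegral_const_mul _ hfr]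
      congr 1
      refine lintegral_congr fun θ => ?_
      rw [indicator_of_mem]
      simp [hr', hN]
    · rw [indicator_of_notMem (by exact hN)]
      simp [indicator, hr', hN]
  rw [setLIntegral_congr_fun measurableSet_Ioi this, lintegral_indicator measurableSet_Iio,
    Measure.restrict_restrict measurableSet_Iio, inter_comm, Ioi_inter_Iio]

/-- Integration over a disk in polar coordinates, for continuous integrable functions. -/
theorem integral_ball_polar {f : ℂ → ℂ} {N : ℝ} (hN : 0 ≤ N)
    (hc : ContinuousOn f (Metric.ball 0 N)) (hf : IntegrableOn f (Metric.ball 0 N)) :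
    ∫ z in Metric.ball 0 N, f z =
      ∫ r in 0..N, (r : ℂ) * ∫ θ in 0..2 * Real.pi, f (circleMap 0 r θ) := by
  have hb : MeasurableSet (Metric.ball (0 : ℂ) N) := Metric.isOpen_ball.measurableSet
  have hcm : Measurable fun p : ℝ × ℝ => circleMap 0 p.1 p.2 := by
    unfold circleMap; fun_prop
  have hg : Measurable ((Metric.ball (0 : ℂ) N).indicator f) := by
    classical
    rw [← piecewise_eq_indicator]
    exact hc.measurable_piecewise continuousOn_const hb
  have hgi : Integrable ((Metric.ball (0 : ℂ) N).indicator f) := (integrable_indicator_iff hb).2 hf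
  have hint : IntegrableOn (fun p : ℝ × ℝ => p.1 • (Metric.ball (0 : ℂ) N).indicator f
      (circleMap 0 p.1 p.2)) (Ioi (0 : ℝ) ×ˢ Ioo (-Real.pi) Real.pi) := by
    refine ⟨(measurable_fst.smul (hg.comp hcm)).aestronglyMeasurable, ?_⟩
    have h1 := Complex.lintegral_comp_polarCoord_symm
      (fun z => ‖(Metric.ball (0 : ℂ) N).indicator f z‖ₑ)
    have h2 : ∫⁻ z, ‖(Metric.ball (0 : ℂ) N).indicator f z‖ₑ < ∞ := hgi.2
    rw [← h1, polarCoord_target] at h2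
    refine lt_of_le_of_lt (le_of_eq ?_) h2
    refine setLIntegral_congr_fun (measurableSet_Ioi.prod measurableSet_Ioo) fun p hp => ?_
    simp only [polarCoord_symm_eq_circleMap, enorm_smul, smul_eq_mul]
    rw [Real.enorm_eq_ofReal (le_of_lt hp.1)]
  rw [← integral_indicator hb, ← Complex.integral_comp_polarCoord_symm, polarCoord_target]
  simp_rw [polarCoord_symm_eq_circleMap]
  rw [Measure.volume_eq_prod] at hint ⊢
  rw [setIntegral_prod _ hint]
  have : ∀ r ∈ Ioi (0 : ℝ), (∫ θ in Ioo (-Real.pi) Real.pi,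
      r • (Metric.ball 0 N).indicator f (circleMap 0 r θ)) =
      (Iio N).indicator (fun r => (r : ℂ) *
        ∫ θ in 0..2 * Real.pi, f (circleMap 0 r θ)) r := by
    intro r hr
    have hr' : |r| = r := abs_of_pos hr
    by_cases hN : r < N
    · rw [indicator_of_mem (by exact hN), integral_smul, Complex.real_smul]
      congr 1
      -- Periodicity trades the angular range `(-π, π)` of polar coordinates for the range `[0, 2π]`
      -- of circle integrals.
      have hper : Function.Periodic (fun θ => f (circleMap 0 r θ)) (2 * Real.pi) :=
        (periodic_circleMap 0 r).comp f
      have h3 := hper.intervalIntegral_add_eq 0 (-Real.pi)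
      rw [zero_add, show -Real.pi + 2 * Real.pi = Real.pi by ring] at h3
      rw [h3, intervalIntegral.integral_of_le (by linarith [Real.pi_pos]),
        integral_Ioc_eq_integral_Ioo]
      refine integral_congr_ae (Filter.Eventually.of_forall fun θ => ?_)
      simp only
      rw [indicator_of_mem]
      simp [hr', hN]
    · rw [indicator_of_notMem (by exact hN)]
      simp [indicator, hr', hN]
  rw [setIntegral_congr_fun measurableSet_Ioi this, integral_indicator measurableSet_Iio,
    Measure.restrict_restrict measurableSet_Iio, inter_comm, Ioi_inter_Iio,
    intervalIntegral.integral_of_le hN, integral_Ioc_eq_integral_Ioo]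

/-! ### The explicit Bergman kernel of the disk. -/

/-- Cauchy's formula on circles for the squared Szegő kernel. -/
theorem circle_integral_bergman {f : ℂ → ℂ} (hf : DifferentiableOn ℂ f (Metric.ball 0 1))
    {w : ℂ} (hw : ‖w‖ < 1) {r : ℝ} (hr : 0 < r) (hr1 : r < 1) :
    ∫ θ in 0..2 * Real.pi, ((1 - w * conj (circleMap 0 r θ)) ^ 2)⁻¹ * f (circleMap 0 r θ) =
      2 * Real.pi * deriv (fun z => z * f z) (r ^ 2 * w) := by
  have hw₀ : (r : ℂ) ^ 2 * w ∈ Metric.ball (0 : ℂ) r := by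
    simp only [mem_ball_zero_iff, norm_mul, norm_pow, Complex.norm_real, Real.norm_eq_abs,
      abs_of_pos hr]
    nlinarith [norm_nonneg w, mul_pos hr hr]
  have key := Complex.two_pi_I_inv_smul_circleIntegral_sub_sq_inv_smul_of_differentiable
    Metric.isOpen_ball (Metric.closedBall_subset_ball hr1)
    (f := fun z => z * f z) (differentiableOn_id.mul hf) hw₀
  rw [← key, circleIntegral, smul_eq_mul, ← mul_assoc]
  have h2 : (2 * Real.pi : ℂ) * (2 * Real.pi * Complex.I)⁻¹ = Complex.I⁻¹ := by
    have : (Real.pi : ℂ) ≠ 0 := by exact_mod_cast Real.pi_ne_zero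
    field_simp
  rw [h2, ← intervalIntegral.integral_const_mul]
  refine intervalIntegral.integral_congr fun θ _ => ?_
  have hz : circleMap 0 r θ ≠ 0 := circleMap_ne_center hr.ne'
  -- On `|z| = r` this turns `1 - w conj z` into `(z - r²w)/z`, so the integrand is that of Cauchy's
  -- formula for the derivative of `z f(z)` at `r²w`.
  have hzz : conj (circleMap 0 r θ) = r ^ 2 / circleMap 0 r θ := by
    rw [eq_div_iff hz, mul_comm, Complex.mul_conj, Complex.normSq_eq_norm_sq]
    simp [abs_of_pos hr]
  simp only [deriv_circleMap, smul_eq_mul]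
  rw [hzz]
  have h3 : circleMap 0 r θ - r ^ 2 * w ≠ 0 := by
    intro h
    have h4 : circleMap 0 r θ = r ^ 2 * w := sub_eq_zero.mp h
    have : ‖circleMap 0 r θ‖ = r := by simp [abs_of_pos hr]
    rw [mem_ball_zero_iff, ← h4, this] at hw₀
    exact lt_irrefl _ hw₀
  generalize circleMap 0 r θ = z at *
  have h5 : 1 - w * (r ^ 2 / z) = (z - r ^ 2 * w) / z := by field_simp
  rw [h5]
  field_simp

theorem norm_one_sub_mul_conj_ge (w η : ℂ) (hη : ‖η‖ ≤ 1) : 1 - ‖w‖ ≤ ‖1 - w * conj η‖ := by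
  have h1 : ‖w * conj η‖ ≤ ‖w‖ := by
    rw [norm_mul, RCLike.norm_conj]
    exact mul_le_of_le_one_right (norm_nonneg _) hη
  have h2 := norm_sub_norm_le (1 : ℂ) (w * conj η)
  rw [norm_one] at h2
  linarith

theorem one_sub_mul_conj_ne_zero {w η : ℂ} (hw : ‖w‖ < 1) (hη : ‖η‖ ≤ 1) :
    1 - w * conj η ≠ 0 := by
  rw [← norm_pos_iff]
  linarith [norm_one_sub_mul_conj_ge w η hη]

theorem continuousOn_bergman_fun {w : ℂ} (hw : ‖w‖ < 1) :
    ContinuousOn (fun η : ℂ => (Real.pi : ℂ)⁻¹ * ((1 - w * conj η) ^ 2)⁻¹) unitDisk := by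
  refine continuousOn_const.mul (ContinuousOn.inv₀ ?_ fun η hη => ?_)
  · exact ((continuous_const.sub (continuous_const.mul Complex.continuous_conj)).pow 2).continuousOn
  · exact pow_ne_zero _ (one_sub_mul_conj_ne_zero hw (mem_ball_zero_iff.1 hη).le)

theorem norm_bergman_fun_le {w η : ℂ} (hw : ‖w‖ < 1) (hη : ‖η‖ ≤ 1) :
    ‖(Real.pi : ℂ)⁻¹ * ((1 - w * conj η) ^ 2)⁻¹‖ ≤ Real.pi⁻¹ * ((1 - ‖w‖) ^ 2)⁻¹ := by
  have h1 := norm_one_sub_mul_conj_ge w η hη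
  have h2 : 0 < 1 - ‖w‖ := by linarith
  rw [norm_mul, norm_inv, norm_inv, norm_pow, Complex.norm_real, Real.norm_of_nonneg Real.pi_pos.le]
  gcongr

/-- The reproducing formula on the disk. -/
theorem reproducing_formula {f : ℂ → ℂ} (hf : DifferentiableOn ℂ f unitDisk)
    (hi : IntegrableOn f unitDisk) {w : ℂ} (hw : w ∈ unitDisk) :
    ∫ η in unitDisk, ((Real.pi : ℂ)⁻¹ * ((1 - w * conj η) ^ 2)⁻¹) * f η = f w := by
  have hw' : ‖w‖ < 1 := mem_ball_zero_iff.1 hw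
  have hmeas : MeasurableSet unitDisk := Metric.isOpen_ball.measurableSet
  have hkc := continuousOn_bergman_fun hw'
  have hint : IntegrableOn (fun η => ((Real.pi : ℂ)⁻¹ * ((1 - w * conj η) ^ 2)⁻¹) * f η)
      unitDisk := by
    refine Integrable.bdd_mul (c := Real.pi⁻¹ * ((1 - ‖w‖) ^ 2)⁻¹) hi
      (hkc.aestronglyMeasurable hmeas) ?_
    filter_upwards [ae_restrict_mem hmeas] with η hη
    exact norm_bergman_fun_le hw' (mem_ball_zero_iff.1 hη).le
  have hmem : ∀ r ∈ Icc (0 : ℝ) 1, (r : ℂ) ^ 2 * w ∈ unitDisk := by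
    intro r hr
    rw [unitDisk, mem_ball_zero_iff, norm_mul, norm_pow, Complex.norm_real, Real.norm_of_nonneg hr.1]
    exact (mul_le_of_le_one_left (norm_nonneg _) (pow_le_one₀ hr.1 hr.2)).trans_lt hw'
  have hd : ∀ z ∈ unitDisk, HasDerivAt f (deriv f z) z := fun z hz =>
    (hf.differentiableAt (Metric.isOpen_ball.mem_nhds hz)).hasDerivAt
  have hg : ∀ z ∈ unitDisk, deriv (fun z => z * f z) z = f z + z * deriv f z := fun z hz => by
    simpa using ((hasDerivAt_id' z).fun_mul (hd z hz)).deriv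
  have hpi : (Real.pi : ℂ) ≠ 0 := by exact_mod_cast Real.pi_ne_zero
  rw [unitDisk, integral_ball_polar zero_le_one (hkc.fun_mul hf.continuousOn) hint]
  have hcongr : ∫ r in (0 : ℝ)..1, (r : ℂ) * ∫ θ in 0..2 * Real.pi,
      ((Real.pi : ℂ)⁻¹ * ((1 - w * conj (circleMap 0 r θ)) ^ 2)⁻¹) * f (circleMap 0 r θ) =
      ∫ r in (0 : ℝ)..1, (2 * r * f (r ^ 2 * w) + r ^ 2 * (deriv f (r ^ 2 * w) * (2 * r * w)) : ℂ) := by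
    rw [intervalIntegral.integral_of_le zero_le_one, intervalIntegral.integral_of_le zero_le_one,
      integral_Ioc_eq_integral_Ioo, integral_Ioc_eq_integral_Ioo]
    refine setIntegral_congr_fun measurableSet_Ioo fun r hr => ?_
    simp only [mul_assoc]
    rw [intervalIntegral.integral_const_mul, circle_integral_bergman hf hw' hr.1 hr.2,
      hg _ (hmem r ⟨hr.1.le, hr.2.le⟩)]
    field_simp
  -- The radial integrand is the exact derivative of `r² f(r²w)`, which is `0` at `r = 0` and `f w`
  -- at `r = 1`.
  rw [hcongr, intervalIntegral.integral_eq_sub_of_hasDerivAt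
    (f := fun r : ℝ => (r : ℂ) ^ 2 * f (r ^ 2 * w))]
  · simp
  · intro r hr
    rw [uIcc_of_le zero_le_one] at hr
    have h1 : HasDerivAt (fun r : ℝ => (r : ℂ) ^ 2) (2 * r) r := by
      simpa using (Complex.ofRealCLM.hasDerivAt (x := r)).fun_pow 2
    have h2 : HasDerivAt (fun r : ℝ => f ((r : ℂ) ^ 2 * w))
        (deriv f (r ^ 2 * w) * (2 * r * w)) r :=
      (hd _ (hmem r hr)).comp r (h1.mul_const w)
    exact h1.mul h2
  · refine ContinuousOn.intervalIntegrable ?_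
    rw [uIcc_of_le zero_le_one]
    have hc1 : ContinuousOn (fun r : ℝ => (r : ℂ) ^ 2 * w) (Icc 0 1) := by fun_prop
    have hc2 := hf.continuousOn.comp hc1 hmem
    have hc3 := (hf.deriv Metric.isOpen_ball).continuousOn.comp hc1 hmem
    have hc4 : ContinuousOn (fun r : ℝ => (2 * r : ℂ)) (Icc 0 1) := by fun_prop
    have hc5 : ContinuousOn (fun r : ℝ => (r : ℂ) ^ 2) (Icc 0 1) := by fun_prop
    exact (hc4.mul hc2).add (hc5.mul (hc3.mul (hc4.mul continuousOn_const)))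

/-- Existence of a kernel is what gives the `Classical.epsilon` choice its defining property. For
fixed `w` the candidate is bounded, hence square integrable on the disk, and its conjugate is
holomorphic in `η`. -/
theorem isBergmanKernel_unitDisk :
    IsBergmanKernel unitDisk fun w η => (Real.pi : ℂ)⁻¹ * ((1 - w * conj η) ^ 2)⁻¹ := by
  intro w hw
  have hw' : ‖w‖ < 1 := mem_ball_zero_iff.1 hw
  have hmeas : MeasurableSet unitDisk := Metric.isOpen_ball.measurableSet
  have : IsFiniteMeasure (volume.restrict unitDisk) :=
    ⟨by rw [Measure.restrict_apply_univ]; exact measure_ball_lt_top⟩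
  refine ⟨⟨?_, ?_⟩, fun f hf => (reproducing_formula hf.1 ?_ hw).symm⟩
  · have : (fun η => conj ((Real.pi : ℂ)⁻¹ * ((1 - w * conj η) ^ 2)⁻¹)) =
        fun η => (Real.pi : ℂ)⁻¹ * ((1 - conj w * η) ^ 2)⁻¹ := by
      ext η; simp
    rw [this]
    refine (DifferentiableOn.inv (by fun_prop) fun η hη => ?_).const_mul _
    have := one_sub_mul_conj_ne_zero hw' (mem_ball_zero_iff.1 hη).le
    refine pow_ne_zero _ fun h => this ?_
    simpa using congrArg conj h
  · refine MemLp.of_bound (Complex.continuous_conj.comp_aestronglyMeasurable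
      ((continuousOn_bergman_fun hw').aestronglyMeasurable hmeas))
      (Real.pi⁻¹ * ((1 - ‖w‖) ^ 2)⁻¹) ?_
    filter_upwards [ae_restrict_mem hmeas] with η hη
    rw [RCLike.norm_conj]
    exact norm_bergman_fun_le hw' (mem_ball_zero_iff.1 hη).le
  · exact hf.2.integrable one_le_two

/-- The function `g = conj (K w - L w)` lies in the Bergman space, so both kernels reproduce `g w`;
subtracting gives `∫ |g|² = 0`. -/
theorem IsBergmanKernel.ae_eq {Ω : Set ℂ} {K L : ℂ → ℂ → ℂ} (hK : IsBergmanKernel Ω K)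
    (hL : IsBergmanKernel Ω L) {w : ℂ} (hw : w ∈ Ω) : K w =ᵐ[volume.restrict Ω] L w := by
  obtain ⟨hK1, hK2⟩ := hK w hw
  obtain ⟨hL1, hL2⟩ := hL w hw
  set g : ℂ → ℂ := fun η => conj (K w η) - conj (L w η) with hg
  have hgm : MemBergmanSpace Ω g := ⟨hK1.1.sub hL1.1, hK1.2.sub hL1.2⟩
  have conjMem : ∀ {f : ℂ → ℂ}, MemLp (fun η => conj (f η)) 2 (volume.restrict Ω) →
      MemLp f 2 (volume.restrict Ω) := fun h => by
      simpa [Function.comp_def, Pi.star_def] using h.star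
  have hKi : Integrable (fun η => K w η * g η) (volume.restrict Ω) :=
    (conjMem hK1.2).integrable_mul hgm.2
  have hLi : Integrable (fun η => L w η * g η) (volume.restrict Ω) :=
    (conjMem hL1.2).integrable_mul hgm.2
  have h0 : ∫ η in Ω, ((‖g η‖ ^ 2 : ℝ) : ℂ) = 0 := by
    have : ∀ η, ((‖g η‖ ^ 2 : ℝ) : ℂ) = K w η * g η - L w η * g η := fun η => by
      rw [← Complex.normSq_eq_norm_sq, ← Complex.mul_conj]
      simp only [hg, map_sub, Complex.conj_conj]
      ring
    simp_rw [this]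
    rw [integral_sub hKi hLi, ← hK2 g hgm, ← hL2 g hgm, sub_self]
  rw [integral_complex_ofReal, Complex.ofReal_eq_zero,
    integral_eq_zero_iff_of_nonneg (fun _ => by positivity) (hgm.2.integrable_norm_pow two_ne_zero)] at h0
  filter_upwards [h0] with η hη
  have : conj (K w η) = conj (L w η) := by simpa [hg, sub_eq_zero] using hη
  exact (starRingEnd ℂ).injective this

theorem norm_bergmanKernel_unitDisk_ae {w : ℂ} (hw : w ∈ unitDisk) :
    ∀ᵐ η ∂volume.restrict unitDisk,
      ‖bergmanKernel unitDisk w η‖ = Real.pi⁻¹ * (‖1 - w * conj η‖ ^ 2)⁻¹ := by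
  have h : IsBergmanKernel unitDisk (bergmanKernel unitDisk) :=
    Classical.epsilon_spec ⟨_, isBergmanKernel_unitDisk⟩
  filter_upwards [h.ae_eq isBergmanKernel_unitDisk hw] with η hη
  rw [hη, norm_mul, norm_inv, norm_inv, norm_pow, Complex.norm_real,
    Real.norm_of_nonneg Real.pi_pos.le]

/-! ### The Forelli–Rudin estimate. -/

theorem lintegral_rpow_Ioc {t d : ℝ} (ht : -1 < t) (hd : 0 ≤ d) :
    ∫⁻ u in Ioc 0 d, ENNReal.ofReal (u ^ t) = ENNReal.ofReal (d ^ (t + 1) / (t + 1)) := by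
  have hi := (intervalIntegral.intervalIntegrable_rpow' (a := 0) (b := d) ht).1
  rw [← ofReal_integral_eq_lintegral_ofReal hi, ← intervalIntegral.integral_of_le hd,
    integral_rpow (Or.inl ht), Real.zero_rpow (by linarith), sub_zero]
  filter_upwards [ae_restrict_mem measurableSet_Ioc] with u hu
  exact Real.rpow_nonneg hu.1.le _

theorem lintegral_rpow_Ioi {t d : ℝ} (ht : t < -1) (hd : 0 < d) :
    ∫⁻ u in Ioi d, ENNReal.ofReal (u ^ t) = ENNReal.ofReal (-d ^ (t + 1) / (t + 1)) := by
  rw [← ofReal_integral_eq_lintegral_ofReal (integrableOn_Ioi_rpow_of_lt ht hd),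
    integral_Ioi_rpow_of_lt ht hd]
  filter_upwards [ae_restrict_mem measurableSet_Ioi] with u hu
  exact Real.rpow_nonneg (hd.trans hu).le _

/-- With `conj z = r²/z` on the circle, one of the two conjugate factors becomes a Cauchy kernel
with pole `r²w`, and Cauchy's formula evaluates the other, `(1 - conj w z)⁻¹`, at that point. -/
theorem integral_circle_szego_sq {w : ℂ} (hw : ‖w‖ < 1) {r : ℝ} (hr : 0 < r) (hr1 : r < 1) :
    ∫ θ in 0..2 * Real.pi, (‖1 - w * conj (circleMap 0 r θ)‖ ^ 2)⁻¹ =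
      2 * Real.pi * (1 - r ^ 2 * ‖w‖ ^ 2)⁻¹ := by
  have hw₀ : (r : ℂ) ^ 2 * w ∈ Metric.ball (0 : ℂ) r := by
    simp only [mem_ball_zero_iff, norm_mul, norm_pow, Complex.norm_real, Real.norm_eq_abs,
      abs_of_pos hr]
    nlinarith [norm_nonneg w, mul_pos hr hr]
  have hne : ∀ z : ℂ, ‖z‖ ≤ 1 → 1 - conj w * z ≠ 0 := fun z hz => by
    simpa using one_sub_mul_conj_ne_zero (w := conj w) (η := conj z) (by simpa using hw)
      (by simpa using hz)
  have hdiff : DifferentiableOn ℂ (fun z => (1 - conj w * z)⁻¹) (Metric.closedBall 0 r) := by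
    refine DifferentiableOn.inv (by fun_prop) fun z hz => hne z ?_
    exact (mem_closedBall_zero_iff.1 hz).trans hr1.le
  have key := hdiff.circleIntegral_sub_inv_smul hw₀
  have hval : 1 - conj w * (r ^ 2 * w) = ((1 - r ^ 2 * ‖w‖ ^ 2 : ℝ) : ℂ) := by
    push_cast
    rw [← Complex.conj_mul']
    ring
  have hC : ∫ θ in 0..2 * Real.pi, (((‖1 - w * conj (circleMap 0 r θ)‖ ^ 2)⁻¹ : ℝ) : ℂ) =
      2 * Real.pi * ((1 - r ^ 2 * ‖w‖ ^ 2 : ℝ) : ℂ)⁻¹ := by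
    have h1 : (2 * Real.pi * ((1 - r ^ 2 * ‖w‖ ^ 2 : ℝ) : ℂ)⁻¹ : ℂ) =
        Complex.I⁻¹ * ((2 * Real.pi * Complex.I) • (1 - conj w * (r ^ 2 * w))⁻¹) := by
      rw [hval, smul_eq_mul]
      have := Complex.I_ne_zero
      field_simp
    rw [h1, ← key, circleIntegral, ← intervalIntegral.integral_const_mul]
    refine intervalIntegral.integral_congr fun θ _ => ?_
    have hz : circleMap 0 r θ ≠ 0 := circleMap_ne_center hr.ne'
    have hzn : ‖circleMap 0 r θ‖ = r := by simp [abs_of_pos hr]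
    have hzz : conj (circleMap 0 r θ) = r ^ 2 / circleMap 0 r θ := by
      rw [eq_div_iff hz, mul_comm, Complex.mul_conj, Complex.normSq_eq_norm_sq, hzn]
      simp
    have hcj : conj (1 - w * conj (circleMap 0 r θ)) = 1 - conj w * circleMap 0 r θ := by simp
    have h2 := hne (circleMap 0 r θ) (hzn.le.trans hr1.le)
    have h3 : circleMap 0 r θ - r ^ 2 * w ≠ 0 := by
      intro h
      rw [mem_ball_zero_iff, ← sub_eq_zero.mp h, hzn] at hw₀
      exact lt_irrefl _ hw₀
    simp only [deriv_circleMap, smul_eq_mul]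
    rw [← Complex.normSq_eq_norm_sq, Complex.ofReal_inv, ← Complex.mul_conj, hcj, hzz]
    have hI := Complex.I_ne_zero
    generalize circleMap 0 r θ = z at *
    have h5 : 1 - w * (r ^ 2 / z) = (z - r ^ 2 * w) / z := by field_simp
    rw [h5]
    field_simp
  rw [intervalIntegral.integral_ofReal] at hC
  exact_mod_cast hC

theorem continuous_szego_sq_circle {w : ℂ} (hw : ‖w‖ < 1) {r : ℝ} (hr : 0 ≤ r) (hr1 : r ≤ 1) :
    Continuous fun θ => (‖1 - w * conj (circleMap 0 r θ)‖ ^ 2)⁻¹ := by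
  refine Continuous.inv₀ ?_ fun θ => ?_
  · have := continuous_circleMap 0 r
    have h2 := Complex.continuous_conj.comp this
    simp only [Function.comp_def] at h2
    fun_prop
  · refine pow_ne_zero _ (norm_ne_zero_iff.2 (one_sub_mul_conj_ne_zero hw ?_))
    simpa [abs_of_nonneg hr] using hr1

theorem lintegral_circle_szego_sq {w : ℂ} (hw : ‖w‖ < 1) {r : ℝ} (hr : 0 < r) (hr1 : r < 1) :
    ∫⁻ θ in Ioo (-Real.pi) Real.pi,
      ENNReal.ofReal (‖1 - w * conj (circleMap 0 r θ)‖ ^ 2)⁻¹ =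
      ENNReal.ofReal (2 * Real.pi * (1 - r ^ 2 * ‖w‖ ^ 2)⁻¹) := by
  have hc := continuous_szego_sq_circle hw hr.le hr1.le
  rw [← integral_circle_szego_sq hw hr hr1, ← ofReal_integral_eq_lintegral_ofReal]
  · congr 1
    have hper : Function.Periodic (fun θ => (‖1 - w * conj (circleMap 0 r θ)‖ ^ 2)⁻¹)
        (2 * Real.pi) := (periodic_circleMap 0 r).comp fun z => (‖1 - w * conj z‖ ^ 2)⁻¹
    have h3 := hper.intervalIntegral_add_eq 0 (-Real.pi)
    rw [zero_add, show -Real.pi + 2 * Real.pi = Real.pi by ring] at h3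
    rw [h3, intervalIntegral.integral_of_le (by linarith [Real.pi_pos]),
      integral_Ioc_eq_integral_Ioo]
  · exact (hc.integrableOn_Icc).mono_set Ioo_subset_Icc_self
  · exact Filter.Eventually.of_forall fun θ => by positivity

/-- Below `d` the integrand is `u^(-s)/d`, integrable at `0` since `s < 1`; above `d` it is
`u^(-s-1)`, integrable at infinity since `s > 0`. Each part is a multiple of `d^(-s)`. -/
theorem lintegral_rpow_div_max_le {s d : ℝ} (hs : 0 < s) (hs1 : s < 1) (hd : 0 < d) :
    ∫⁻ u in Ioo 0 1, ENNReal.ofReal (u ^ (-s) / max u d) ≤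
      ENNReal.ofReal ((1 / (1 - s) + 1 / s) * d ^ (-s)) := by
  have hsub : Ioo (0 : ℝ) 1 ⊆ Ioc 0 d ∪ Ioi d := fun u hu => by
    rcases le_or_gt u d with h | h
    · exact Or.inl ⟨hu.1, h⟩
    · exact Or.inr h
  refine (lintegral_mono_set hsub).trans ((lintegral_union_le _ _ _).trans ?_)
  have h1 : ∫⁻ u in Ioc 0 d, ENNReal.ofReal (u ^ (-s) / max u d) ≤
      ENNReal.ofReal (1 / (1 - s) * d ^ (-s)) := by
    calc _ ≤ ∫⁻ u in Ioc 0 d, ENNReal.ofReal d⁻¹ * ENNReal.ofReal (u ^ (-s)) := by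
          refine setLIntegral_mono' measurableSet_Ioc fun u hu => ?_
          rw [max_eq_right hu.2, ← ENNReal.ofReal_mul (by positivity), div_eq_inv_mul]
      _ = ENNReal.ofReal (1 / (1 - s) * d ^ (-s)) := by
          rw [lintegral_const_mul' _ _ ENNReal.ofReal_ne_top, lintegral_rpow_Ioc (by linarith) hd.le,
            ← ENNReal.ofReal_mul (by positivity), Real.rpow_add_one hd.ne']
          congr 1
          have : 1 - s ≠ 0 := by linarith
          rw [show -s + 1 = 1 - s by ring]
          field_simp
  have h2 : ∫⁻ u in Ioi d, ENNReal.ofReal (u ^ (-s) / max u d) ≤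
      ENNReal.ofReal (1 / s * d ^ (-s)) := by
    calc _ ≤ ∫⁻ u in Ioi d, ENNReal.ofReal (u ^ (-s - 1)) := by
          refine setLIntegral_mono' measurableSet_Ioi fun u hu => ?_
          rw [max_eq_left (le_of_lt hu), Real.rpow_sub_one (hd.trans hu).ne']
      _ = ENNReal.ofReal (1 / s * d ^ (-s)) := by
          rw [lintegral_rpow_Ioi (by linarith) hd]
          congr 1
          rw [show -s - 1 + 1 = -s by ring]
          field_simp
  refine (add_le_add h1 h2).trans (le_of_eq ?_)
  have : 0 < 1 - s := by linarith
  rw [← ENNReal.ofReal_add (by positivity) (by positivity)]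
  congr 1
  ring

theorem measurable_conj_norm (w : ℂ) : Measurable fun η : ℂ => (‖1 - w * conj η‖ ^ 2)⁻¹ := by
  have := Complex.continuous_conj.measurable
  fun_prop

/-- The Forelli–Rudin estimate for the disk. -/
theorem forelli_rudin {s : ℝ} (hs : 0 < s) (hs1 : s < 1) {w : ℂ} (hw : ‖w‖ < 1) :
    ∫⁻ η in unitDisk, ENNReal.ofReal ((‖1 - w * conj η‖ ^ 2)⁻¹ * (1 - ‖η‖) ^ (-s)) ≤
      ENNReal.ofReal (2 * Real.pi * (1 / (1 - s) + 1 / s) * (1 - ‖w‖) ^ (-s)) := by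
  have hd : 0 < 1 - ‖w‖ := by linarith
  have hpi := Real.pi_pos
  have hmeas : Measurable fun η : ℂ =>
      ENNReal.ofReal ((‖1 - w * conj η‖ ^ 2)⁻¹ * (1 - ‖η‖) ^ (-s)) :=
    ENNReal.measurable_ofReal.comp ((measurable_conj_norm w).mul (by fun_prop))
  rw [unitDisk, lintegral_ball_polar hmeas]
  have hstep : ∀ r ∈ Ioo (0 : ℝ) 1, ENNReal.ofReal r * ∫⁻ θ in Ioo (-Real.pi) Real.pi,
      ENNReal.ofReal ((‖1 - w * conj (circleMap 0 r θ)‖ ^ 2)⁻¹ *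
        (1 - ‖circleMap 0 r θ‖) ^ (-s)) ≤
      ENNReal.ofReal (2 * Real.pi) *
        ENNReal.ofReal ((1 - r) ^ (-s) / max (1 - r) (1 - ‖w‖)) := by
    intro r hr
    have hr1 : 0 < 1 - r := by linarith [hr.2]
    have hnorm : ∀ θ, ‖circleMap 0 r θ‖ = r := fun θ => by simp [abs_of_pos hr.1]
    simp_rw [hnorm]
    have h1 : ∀ θ, ENNReal.ofReal ((‖1 - w * conj (circleMap 0 r θ)‖ ^ 2)⁻¹ * (1 - r) ^ (-s)) =
        ENNReal.ofReal (‖1 - w * conj (circleMap 0 r θ)‖ ^ 2)⁻¹ * ENNReal.ofReal ((1 - r) ^ (-s)) :=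
      fun θ => ENNReal.ofReal_mul (by positivity)
    simp_rw [h1]
    have hnn : 0 ≤ ‖w‖ := norm_nonneg w
    -- The circle mean is thus controlled by the larger of the two distances to the boundary, which
    -- leaves a one-variable integral.
    have hq : max (1 - r) (1 - ‖w‖) ≤ 1 - r ^ 2 * ‖w‖ ^ 2 := by
      have h3 : r ^ 2 ≤ r := by nlinarith [hr.1, hr.2]
      have h4 : ‖w‖ ^ 2 ≤ ‖w‖ := by nlinarith
      have h5 : r ^ 2 * ‖w‖ ^ 2 ≤ r * ‖w‖ := mul_le_mul h3 h4 (by positivity) hr.1.le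
      refine max_le ?_ ?_
      · nlinarith [hr.1]
      · nlinarith [hr.1, hr.2]
    have hmax : 0 < max (1 - r) (1 - ‖w‖) := lt_max_of_lt_left hr1
    rw [lintegral_mul_const' _ _ ENNReal.ofReal_ne_top, lintegral_circle_szego_sq hw hr.1 hr.2,
      ← ENNReal.ofReal_mul (by have := hmax.trans_le hq; positivity),
      ← ENNReal.ofReal_mul hr.1.le, ← ENNReal.ofReal_mul (by positivity)]
    refine ENNReal.ofReal_le_ofReal ?_
    calc r * (2 * Real.pi * (1 - r ^ 2 * ‖w‖ ^ 2)⁻¹ * (1 - r) ^ (-s))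
        ≤ 1 * (2 * Real.pi * (max (1 - r) (1 - ‖w‖))⁻¹ * (1 - r) ^ (-s)) := by
          have := hmax.trans_le hq
          gcongr
          exact hr.2.le
      _ = _ := by ring
  refine (setLIntegral_mono' measurableSet_Ioo hstep).trans ?_
  rw [lintegral_const_mul' _ _ ENNReal.ofReal_ne_top]
  have hsub : ∫⁻ r in Ioo (0 : ℝ) 1, ENNReal.ofReal ((1 - r) ^ (-s) / max (1 - r) (1 - ‖w‖)) =
      ∫⁻ u in Ioo (0 : ℝ) 1, ENNReal.ofReal (u ^ (-s) / max u (1 - ‖w‖)) := by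
    rw [← lintegral_indicator measurableSet_Ioo, ← lintegral_indicator measurableSet_Ioo,
      ← lintegral_sub_left_eq_self ((Ioo (0 : ℝ) 1).indicator _) (1 : ℝ)]
    refine lintegral_congr fun r => ?_
    by_cases h : r ∈ Ioo (0 : ℝ) 1
    · have h' : 1 - r ∈ Ioo (0 : ℝ) 1 := ⟨by linarith [h.2], by linarith [h.1]⟩
      simp only [indicator_of_mem h, indicator_of_mem h', sub_sub_cancel]
    · have h' : 1 - r ∉ Ioo (0 : ℝ) 1 := fun h' => h ⟨by linarith [h'.2], by linarith [h'.1]⟩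
      simp only [indicator_of_notMem h, indicator_of_notMem h']
  rw [hsub]
  refine (mul_le_mul_right (lintegral_rpow_div_max_le hs hs1 hd) _).trans (le_of_eq ?_)
  rw [← ENNReal.ofReal_mul (by positivity), ← mul_assoc]

/-! ### The Schur test function and its integral against the kernel. -/

theorem lintegral_ball_rpow_neg_le {t : ℝ} (ht : t < 2) (a : ℂ) {N : ℝ} (hN : 0 ≤ N) :
    ∫⁻ η in Metric.ball a N, ENNReal.ofReal (‖η - a‖ ^ (-t)) ≤
      ENNReal.ofReal (2 * Real.pi / (2 - t) * N ^ (2 - t)) := by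
  have hpi := Real.pi_pos
  have htr : ∫⁻ η in Metric.ball a N, ENNReal.ofReal (‖η - a‖ ^ (-t)) =
      ∫⁻ η in Metric.ball (0 : ℂ) N, ENNReal.ofReal (‖η‖ ^ (-t)) := by
    rw [← lintegral_indicator Metric.isOpen_ball.measurableSet,
      ← lintegral_indicator Metric.isOpen_ball.measurableSet, ← lintegral_sub_right_eq_self ((Metric.ball (0 : ℂ) N).indicator _) a]
    refine lintegral_congr fun η => ?_
    simp only [indicator, mem_ball_iff_norm, sub_zero]
  have hm : Measurable fun η : ℂ => ENNReal.ofReal (‖η‖ ^ (-t)) := by fun_prop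
  rw [htr, lintegral_ball_polar hm]
  calc _ = ∫⁻ r in Ioo 0 N, ENNReal.ofReal (2 * Real.pi) * ENNReal.ofReal (r ^ (1 - t)) := by
        refine setLIntegral_congr_fun measurableSet_Ioo fun r hr => ?_
        have hnorm : ∀ θ, ‖circleMap 0 r θ‖ = r := fun θ => by simp [abs_of_pos hr.1]
        simp only [hnorm, lintegral_const, Measure.restrict_apply_univ, Real.volume_Ioo]
        rw [sub_eq_add_neg 1 t, Real.rpow_add hr.1, Real.rpow_one,
          ENNReal.ofReal_mul hr.1.le, show Real.pi - -Real.pi = 2 * Real.pi by ring]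
        ring
    _ ≤ ∫⁻ r in Ioc 0 N, ENNReal.ofReal (2 * Real.pi) * ENNReal.ofReal (r ^ (1 - t)) :=
        lintegral_mono_set Ioo_subset_Ioc_self
    _ = _ := by
        rw [lintegral_const_mul' _ _ ENNReal.ofReal_ne_top, lintegral_rpow_Ioc (by linarith) hN,
          ← ENNReal.ofReal_mul (by positivity)]
        congr 1
        rw [show 1 - t + 1 = 2 - t by ring]
        ring

/-- The pseudohyperbolic distance is at most `1`. With the triangle inequality this gives `|w - a| ≤
|1 - w conj η| + |η - a|`. -/
theorem norm_sub_le_norm_one_sub_mul_conj {w η : ℂ} (hw : ‖w‖ ≤ 1) (hη : ‖η‖ ≤ 1) :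
    ‖w - η‖ ≤ ‖1 - w * conj η‖ := by
  have key : ‖1 - w * conj η‖ ^ 2 - ‖w - η‖ ^ 2 = (1 - ‖w‖ ^ 2) * (1 - ‖η‖ ^ 2) := by
    simp only [← Complex.normSq_eq_norm_sq, Complex.normSq_apply, Complex.sub_re, Complex.sub_im,
      Complex.mul_re, Complex.mul_im, Complex.one_re, Complex.one_im, Complex.conj_re,
      Complex.conj_im]
    ring
  have h1 : 0 ≤ 1 - ‖w‖ ^ 2 := by nlinarith [norm_nonneg w]
  have h2 : 0 ≤ 1 - ‖η‖ ^ 2 := by nlinarith [norm_nonneg η]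
  refine le_of_sq_le_sq ?_ (norm_nonneg _)
  nlinarith [mul_nonneg h1 h2]

/-- Write `1 - w conj η = (1 - |w|²) + w conj (w - η)` and pass from `w` to `η` through `a`. It
confines the region where `η` is close to `a` to a disk of radius `2(1 - |w|) + |w - a|`. -/
theorem norm_one_sub_mul_conj_le {w : ℂ} (hw : ‖w‖ ≤ 1) (a η : ℂ) :
    ‖1 - w * conj η‖ ≤ 2 * (1 - ‖w‖) + ‖w - a‖ + ‖η - a‖ := by
  have h1 : 1 - w * conj η = ((1 - ‖w‖ ^ 2 : ℝ) : ℂ) + w * conj ((w - a) - (η - a)) := by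
    push_cast
    rw [← Complex.mul_conj', sub_sub_sub_cancel_right, map_sub]
    ring
  have h2 : ‖((1 - ‖w‖ ^ 2 : ℝ) : ℂ)‖ ≤ 2 * (1 - ‖w‖) := by
    rw [Complex.norm_real, Real.norm_of_nonneg] <;> nlinarith [norm_nonneg w]
  have h3 : ‖w * conj ((w - a) - (η - a))‖ ≤ ‖w - a‖ + ‖η - a‖ := by
    rw [norm_mul, RCLike.norm_conj]
    exact (mul_le_of_le_one_left (norm_nonneg _) hw).trans (norm_sub_le _ _)
  rw [h1]
  linarith [norm_add_le ((1 - ‖w‖ ^ 2 : ℝ) : ℂ) (w * conj ((w - a) - (η - a)))]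

/-- Pointwise domination of the Schur test integrand. -/
theorem schur_integrand_le {τ t q σ x y ρ δ R : ℝ} (hτ : 0 < τ) (ht : t < 2)
    (hq : (t / τ).HolderConjugate q) (hx : 0 < x) (hy : 0 < y) (hρ : 0 < ρ) (hδ : 0 < δ)
    (hR : 0 < R) (hRx : R ≤ x + y) (hδx : δ ≤ x) (hxN : x ≤ 2 * δ + R + y) :
    (x ^ 2)⁻¹ * (ρ ^ (-σ) * y ^ (-τ)) ≤ δ ^ (-σ) * R ^ (-τ) * 5 ^ τ *
      (δ ^ σ * ((x ^ 2)⁻¹ * ρ ^ (-σ)) + δ ^ (σ * q) * ((x ^ 2)⁻¹ * ρ ^ (-(σ * q))) +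
        64 * (2 * δ + R) ^ (t - 2) * (Iio (2 * δ + R)).indicator (fun y => y ^ (-t)) y) := by
  have ht0 : 0 < t := by
    have := mul_pos hq.pos hτ
    rwa [div_mul_cancel₀ _ hτ.ne'] at this
  have hN : 0 < 2 * δ + R := by positivity
  have hind : 0 ≤ (Iio (2 * δ + R)).indicator (fun y : ℝ => y ^ (-t)) y :=
    indicator_apply_nonneg fun _ => by positivity
  -- Dividing by the desired bound `δ^(-σ) R^(-τ)` leaves only the ratios `R/y` and `δ/ρ`.
  suffices h : (x ^ 2)⁻¹ * ((R / y) ^ τ * (δ / ρ) ^ σ) ≤ 5 ^ τ *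
      ((x ^ 2)⁻¹ * (δ / ρ) ^ σ + (x ^ 2)⁻¹ * (δ / ρ) ^ (σ * q) +
        64 * (2 * δ + R) ^ (t - 2) * (Iio (2 * δ + R)).indicator (fun y => y ^ (-t)) y) by
    have e1 : (x ^ 2)⁻¹ * (ρ ^ (-σ) * y ^ (-τ)) =
        δ ^ (-σ) * R ^ (-τ) * ((x ^ 2)⁻¹ * ((R / y) ^ τ * (δ / ρ) ^ σ)) := by
      simp only [Real.div_rpow hR.le hy.le, Real.div_rpow hδ.le hρ.le, Real.rpow_neg hρ.le,
        Real.rpow_neg hy.le, Real.rpow_neg hδ.le, Real.rpow_neg hR.le]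
      field_simp
    rw [e1, mul_assoc (δ ^ (-σ) * R ^ (-τ))]
    refine (mul_le_mul_of_nonneg_left h (by positivity)).trans (le_of_eq ?_)
    rw [Real.div_rpow hδ.le hρ.le, Real.div_rpow hδ.le hρ.le, Real.rpow_neg hρ.le,
      Real.rpow_neg hρ.le]
    ring
  -- If `x ≤ 4y`, then `R ≤ x + y ≤ 5y` and the factor in `y` is harmless. If `y < x/4`, the point
  -- is near `a` and the two singular factors must be separated.
  rcases le_or_gt (x / 4) y with hxy | hxy
  · have h1 : R / y ≤ 5 := by rw [div_le_iff₀ hy]; linarith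
    have h2 : (R / y) ^ τ ≤ 5 ^ τ := Real.rpow_le_rpow (by positivity) h1 hτ.le
    calc (x ^ 2)⁻¹ * ((R / y) ^ τ * (δ / ρ) ^ σ) ≤ (x ^ 2)⁻¹ * (5 ^ τ * (δ / ρ) ^ σ) := by gcongr
      _ = 5 ^ τ * ((x ^ 2)⁻¹ * (δ / ρ) ^ σ) := by ring
      _ ≤ _ := by
        gcongr
        rw [add_assoc]
        exact le_add_of_nonneg_right (by positivity)
  · have h1 : R / y ≤ 5 * (x / y) := by
      rw [div_le_iff₀ hy, mul_assoc, div_mul_cancel₀ _ hy.ne']; linarith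
    have h2 : (R / y) ^ τ ≤ 5 ^ τ * (x / y) ^ τ := by
      rw [← Real.mul_rpow (by norm_num) (by positivity)]
      exact Real.rpow_le_rpow (by positivity) h1 hτ.le
    have h3 : (x / y) ^ τ * (δ / ρ) ^ σ ≤ (x / y) ^ t + (δ / ρ) ^ (σ * q) := by
      have hY := Real.young_inequality_of_nonneg (a := (x / y) ^ τ) (b := (δ / ρ) ^ σ)
        (by positivity) (by positivity) hq
      rw [← Real.rpow_mul (by positivity), ← Real.rpow_mul (by positivity),
        mul_div_cancel₀ _ hτ.ne'] at hY
      refine hY.trans (add_le_add (div_le_self (by positivity) hq.lt.le)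
        (div_le_self (by positivity) hq.symm.lt.le))
    have h4 : (x ^ 2)⁻¹ * (x / y) ^ t ≤ 64 * (2 * δ + R) ^ (t - 2) * y ^ (-t) := by
      have e : (x ^ 2)⁻¹ * (x / y) ^ t = x ^ (t - 2) * y ^ (-t) := by
        rw [Real.div_rpow hx.le hy.le, Real.rpow_neg hy.le, Real.rpow_sub hx, Real.rpow_two]
        ring
      rw [e]
      gcongr
      -- Here `R ≤ x + y < 5x/4` and `δ ≤ x`, so `2δ + R ≤ 4x`; the exponent is negative. The
      -- constant `64 = 4³` is a crude bound for `4^(2-t)`.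
      calc x ^ (t - 2) ≤ ((2 * δ + R) / 4) ^ (t - 2) :=
            Real.rpow_le_rpow_of_nonpos (by positivity) (by linarith) (by linarith)
        _ = 4 ^ (2 - t) * (2 * δ + R) ^ (t - 2) := by
            rw [Real.div_rpow hN.le (by norm_num), ← neg_sub 2 t, Real.rpow_neg (x := 4) (by norm_num),
              div_inv_eq_mul, mul_comm]
        _ ≤ 64 * (2 * δ + R) ^ (t - 2) := by
            gcongr
            calc (4 : ℝ) ^ (2 - t) ≤ 4 ^ (3 : ℝ) :=
                  Real.rpow_le_rpow_of_exponent_le (by norm_num) (by linarith)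
              _ = 64 := by norm_num
    have hmem : y ∈ Iio (2 * δ + R) := by rw [mem_Iio]; linarith
    rw [indicator_of_mem hmem]
    calc (x ^ 2)⁻¹ * ((R / y) ^ τ * (δ / ρ) ^ σ)
        ≤ (x ^ 2)⁻¹ * (5 ^ τ * (x / y) ^ τ * (δ / ρ) ^ σ) := by gcongr
      _ = 5 ^ τ * ((x ^ 2)⁻¹ * ((x / y) ^ τ * (δ / ρ) ^ σ)) := by ring
      _ ≤ 5 ^ τ * ((x ^ 2)⁻¹ * ((x / y) ^ t + (δ / ρ) ^ (σ * q))) := by gcongr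
      _ = 5 ^ τ * ((x ^ 2)⁻¹ * (x / y) ^ t + (x ^ 2)⁻¹ * (δ / ρ) ^ (σ * q)) := by ring
      _ ≤ 5 ^ τ * (64 * (2 * δ + R) ^ (t - 2) * y ^ (-t) + (x ^ 2)⁻¹ * (δ / ρ) ^ (σ * q)) := by
        gcongr
      _ ≤ _ := by
        refine mul_le_mul_of_nonneg_left ?_ (by positivity)
        have : 0 ≤ (x ^ 2)⁻¹ * (δ / ρ) ^ σ := by positivity
        linarith

/-- The Schur test inequality for the weight `(1 - |η|)^(-σ) |η - a|^(-τ)`, uniformly in `a`. -/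
theorem lintegral_schur_weight_le {τ t q σ : ℝ} (hτ : 0 < τ) (ht : t < 2)
    (hq : (t / τ).HolderConjugate q) (hσ : 0 < σ) (hσ1 : σ < 1) (hσq : σ * q < 1) :
    ∃ C : ℝ, 0 ≤ C ∧ ∀ w ∈ unitDisk, ∀ a : ℂ, w ≠ a →
      ∫⁻ η in unitDisk, ENNReal.ofReal
        ((‖1 - w * conj η‖ ^ 2)⁻¹ * ((1 - ‖η‖) ^ (-σ) * ‖η - a‖ ^ (-τ))) ≤
      ENNReal.ofReal (C * ((1 - ‖w‖) ^ (-σ) * ‖w - a‖ ^ (-τ))) := by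
  have hpi := Real.pi_pos
  have hs : 0 < σ * q := mul_pos hσ hq.symm.pos
  have hs1' : 0 < 1 - σ := by linarith
  have hs2' : 0 < 1 - σ * q := by linarith
  have ht2 : 0 < 2 - t := by linarith
  set C₁ := 2 * Real.pi * (1 / (1 - σ) + 1 / σ) with hC₁
  set C₂ := 2 * Real.pi * (1 / (1 - σ * q) + 1 / (σ * q)) with hC₂
  set C₃ := 2 * Real.pi / (2 - t) with hC₃
  have hC₁' : 0 ≤ C₁ := by positivity
  have hC₂' : 0 ≤ C₂ := by positivity
  have hC₃' : 0 ≤ C₃ := by positivity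
  refine ⟨5 ^ τ * (C₁ + C₂ + 64 * C₃), by positivity, fun w hw a hwa => ?_⟩
  have hw' : ‖w‖ < 1 := mem_ball_zero_iff.1 hw
  have hmeas : MeasurableSet unitDisk := Metric.isOpen_ball.measurableSet
  set δ := 1 - ‖w‖ with hδ
  have hδ0 : 0 < δ := by linarith
  set R := ‖w - a‖ with hRdef
  have hR0 : 0 < R := norm_pos_iff.2 (sub_ne_zero.2 hwa)
  have hN : 0 < 2 * δ + R := by positivity
  set A := δ ^ (-σ) * R ^ (-τ) * 5 ^ τ with hA
  have hA0 : 0 ≤ A := by positivity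
  have hk := measurable_conj_norm w
  have hm1 : ∀ s : ℝ, Measurable fun η : ℂ =>
      ENNReal.ofReal ((‖1 - w * conj η‖ ^ 2)⁻¹ * (1 - ‖η‖) ^ (-s)) := fun s =>
    ENNReal.measurable_ofReal.comp (hk.mul (by fun_prop))
  have hpt : ∀ᵐ η ∂volume.restrict unitDisk, ENNReal.ofReal
      ((‖1 - w * conj η‖ ^ 2)⁻¹ * ((1 - ‖η‖) ^ (-σ) * ‖η - a‖ ^ (-τ))) ≤
      ENNReal.ofReal A *
      (ENNReal.ofReal (δ ^ σ) * ENNReal.ofReal ((‖1 - w * conj η‖ ^ 2)⁻¹ * (1 - ‖η‖) ^ (-σ)) +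
      ENNReal.ofReal (δ ^ (σ * q)) *
        ENNReal.ofReal ((‖1 - w * conj η‖ ^ 2)⁻¹ * (1 - ‖η‖) ^ (-(σ * q))) +
      ENNReal.ofReal (64 * (2 * δ + R) ^ (t - 2)) *
        (Metric.ball a (2 * δ + R)).indicator (fun η => ENNReal.ofReal (‖η - a‖ ^ (-t))) η) := by
    have hne : ∀ᵐ η ∂volume.restrict unitDisk, η ≠ a :=
      ae_restrict_of_ae (Measure.ae_ne volume a)
    filter_upwards [ae_restrict_mem hmeas, hne] with η hη hηa
    have hη' : ‖η‖ < 1 := mem_ball_zero_iff.1 hη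
    have hρ : 0 < 1 - ‖η‖ := by linarith
    have hind : (Metric.ball a (2 * δ + R)).indicator
        (fun η => ENNReal.ofReal (‖η - a‖ ^ (-t))) η =
        ENNReal.ofReal ((Iio (2 * δ + R)).indicator (fun y => y ^ (-t)) ‖η - a‖) := by
      simp only [indicator, mem_ball_iff_norm, mem_Iio]
      split_ifs <;> simp
    have hnn : 0 ≤ (Iio (2 * δ + R)).indicator (fun y : ℝ => y ^ (-t)) ‖η - a‖ :=
      indicator_apply_nonneg fun _ => by positivity
    rw [hind, ← ENNReal.ofReal_mul (by positivity), ← ENNReal.ofReal_mul (by positivity),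
      ← ENNReal.ofReal_mul (by positivity), ← ENNReal.ofReal_add (by positivity) (by positivity),
      ← ENNReal.ofReal_add (by positivity) (by positivity), ← ENNReal.ofReal_mul hA0]
    refine ENNReal.ofReal_le_ofReal (schur_integrand_le hτ ht hq
      (norm_pos_iff.2 (one_sub_mul_conj_ne_zero hw' hη'.le))
      (norm_pos_iff.2 (sub_ne_zero.2 hηa)) hρ hδ0 hR0 ?_
      (norm_one_sub_mul_conj_ge w η hη'.le) (norm_one_sub_mul_conj_le hw'.le a η))
    have h1 := norm_sub_le_norm_one_sub_mul_conj hw'.le hη'.le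
    have h2 := norm_sub_le_norm_sub_add_norm_sub w η a
    linarith
  have hball : ∫⁻ η in unitDisk, (Metric.ball a (2 * δ + R)).indicator
      (fun η => ENNReal.ofReal (‖η - a‖ ^ (-t))) η ≤
      ENNReal.ofReal (C₃ * (2 * δ + R) ^ (2 - t)) := by
    refine (setLIntegral_le_lintegral _ _).trans ?_
    rw [lintegral_indicator Metric.isOpen_ball.measurableSet]
    exact lintegral_ball_rpow_neg_le ht a hN.le
  refine (lintegral_mono_ae hpt).trans ?_
  rw [lintegral_const_mul' _ _ ENNReal.ofReal_ne_top,
    lintegral_add_left (((hm1 _).const_mul _).fun_add ((hm1 _).const_mul _)),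
    lintegral_add_left ((hm1 _).const_mul _), lintegral_const_mul' _ _ ENNReal.ofReal_ne_top,
    lintegral_const_mul' _ _ ENNReal.ofReal_ne_top, lintegral_const_mul' _ _ ENNReal.ofReal_ne_top]
  calc _ ≤ ENNReal.ofReal A * (ENNReal.ofReal (δ ^ σ) * ENNReal.ofReal (C₁ * δ ^ (-σ)) +
        ENNReal.ofReal (δ ^ (σ * q)) * ENNReal.ofReal (C₂ * δ ^ (-(σ * q))) +
        ENNReal.ofReal (64 * (2 * δ + R) ^ (t - 2)) *
          ENNReal.ofReal (C₃ * (2 * δ + R) ^ (2 - t))) := by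
        gcongr
        · exact forelli_rudin hσ hσ1 hw'
        · exact forelli_rudin hs hσq hw'
    _ = _ := by
        rw [← ENNReal.ofReal_mul (by positivity), ← ENNReal.ofReal_mul (by positivity),
          ← ENNReal.ofReal_mul (by positivity), ← ENNReal.ofReal_add (by positivity) (by positivity),
          ← ENNReal.ofReal_add (by positivity) (by positivity), ← ENNReal.ofReal_mul hA0]
        congr 1
        -- All powers of `δ` and of `2δ + R` inside the bracket cancel, which makes the constant
        -- independent of `w` and `a`.
        rw [← neg_sub 2 t, Real.rpow_neg hN.le, hA]
        simp only [Real.rpow_neg hδ0.le]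
        field_simp

/-! ### Schur's test with weights. -/

/-- Hölder's inequality in the form used by the Schur test. -/
theorem lintegral_mul_le_schur {α : Type*} [MeasurableSpace α] {μ : Measure α} {p q : ℝ}
    (hpq : p.HolderConjugate q) {K H f : α → ℝ≥0∞} (hK : AEMeasurable K μ) (hH : AEMeasurable H μ)
    (hf : AEMeasurable f μ) (hH0 : ∀ᵐ x ∂μ, H x ≠ 0) (hHt : ∀ᵐ x ∂μ, H x ≠ ∞) :
    ∫⁻ x, K x * f x ∂μ ≤ (∫⁻ x, K x * H x ∂μ) ^ (1 / q) *
      (∫⁻ x, K x * (H x ^ (-(p - 1)) * f x ^ p) ∂μ) ^ (1 / p) := by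
  have hp := hpq.pos
  have hq := hpq.symm.pos
  have hsum : 1 / q + 1 / p = 1 := by simpa using hpq.symm.inv_add_inv_eq_one
  -- The splitting is `K f = (K H)^(1/q) · K^(1/p) H^(-1/q) f`; since `p/q = p - 1`, the `p`-th
  -- power of the second factor carries `H^(-(p-1))`.
  have h := ENNReal.lintegral_mul_le_Lp_mul_Lq μ hpq.symm
    (f := fun x => (K x * H x) ^ (1 / q)) (g := fun x => K x ^ (1 / p) * (H x ^ (-(1 / q)) * f x))
    ((hK.mul hH).pow_const _) ((hK.pow_const _).mul ((hH.pow_const _).mul hf))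
  have e1 : ∀ x, ((K x * H x) ^ (1 / q)) ^ q = K x * H x := fun x => by
    rw [← ENNReal.rpow_mul, one_div_mul_cancel hq.ne', ENNReal.rpow_one]
  have e2 : ∀ x, (K x ^ (1 / p) * (H x ^ (-(1 / q)) * f x)) ^ p =
      K x * (H x ^ (-(p - 1)) * f x ^ p) := fun x => by
    rw [ENNReal.mul_rpow_of_nonneg _ _ hp.le, ENNReal.mul_rpow_of_nonneg _ _ hp.le,
      ← ENNReal.rpow_mul, one_div_mul_cancel hp.ne', ENNReal.rpow_one, ← ENNReal.rpow_mul]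
    have : -(1 / q) * p = -(p - 1) := by
      rw [eq_sub_of_add_eq hsum]
      field_simp
    rw [this]
  simp only [e1, e2] at h
  refine (lintegral_mono_ae ?_).trans h
  filter_upwards [hH0, hHt] with x h0 ht
  refine le_of_eq ?_
  simp only [Pi.mul_apply]
  rw [ENNReal.mul_rpow_of_nonneg _ _ (by positivity)]
  have h1 : K x ^ (1 / q) * K x ^ (1 / p) = K x := by
    rw [← ENNReal.rpow_add_of_nonneg _ _ (by positivity) (by positivity), hsum, ENNReal.rpow_one]
  have h2 : H x ^ (1 / q) * H x ^ (-(1 / q)) = 1 := by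
    rw [← ENNReal.rpow_add _ _ h0 ht, add_neg_cancel, ENNReal.rpow_zero]
  calc K x * f x = (K x ^ (1 / q) * K x ^ (1 / p)) * (H x ^ (1 / q) * H x ^ (-(1 / q))) * f x := by
        rw [h1, h2, mul_one]
    _ = _ := by ring

/-- The Schur test for a positive integral operator on a weighted `L^p` space. -/
theorem schur_test {α : Type*} [MeasurableSpace α] {μ : Measure α} [SFinite μ] {p q : ℝ}
    (hpq : p.HolderConjugate q) {K : α → α → ℝ≥0∞} {H W f : α → ℝ≥0∞}
    (hK : Measurable (Function.uncurry K)) (hH : Measurable H) (hW : Measurable W)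
    (hf : AEMeasurable f μ) (hH0 : ∀ᵐ x ∂μ, H x ≠ 0) (hHt : ∀ᵐ x ∂μ, H x ≠ ∞) {C₁ C₂ : ℝ≥0∞}
    (h₁ : ∀ᵐ x ∂μ, ∫⁻ y, K x y * H y ∂μ ≤ C₁ * H x)
    (h₂ : ∀ᵐ y ∂μ, ∫⁻ x, K x y * (H x ^ (p - 1) * W x) ∂μ ≤ C₂ * (H y ^ (p - 1) * W y)) :
    ∫⁻ x, W x * (∫⁻ y, K x y * f y ∂μ) ^ p ∂μ ≤
      C₁ ^ (p - 1) * C₂ * ∫⁻ y, W y * f y ^ p ∂μ := by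
  have hp := hpq.pos
  have hp1 : 0 ≤ p - 1 := by linarith [hpq.lt]
  have hKx : ∀ x, Measurable (K x) := fun x => hK.comp measurable_prodMk_left
  have hKy : ∀ y, Measurable fun x => K x y := fun y => hK.comp measurable_prodMk_right
  have hHW : Measurable fun x => H x ^ (p - 1) * W x := (hH.pow_const _).mul hW
  have hHf : AEMeasurable (fun y => H y ^ (-(p - 1)) * f y ^ p) μ :=
    (hH.pow_const _).aemeasurable.mul (hf.pow_const _)
  have hstep : ∀ᵐ x ∂μ, W x * (∫⁻ y, K x y * f y ∂μ) ^ p ≤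
      C₁ ^ (p - 1) * ∫⁻ y, (H x ^ (p - 1) * W x) * (K x y * (H y ^ (-(p - 1)) * f y ^ p)) ∂μ := by
    filter_upwards [h₁] with x hx
    have h := lintegral_mul_le_schur hpq (hKx x).aemeasurable hH.aemeasurable hf hH0 hHt
    rw [lintegral_const_mul'' _ ((hKx x).aemeasurable.fun_mul hHf)]
    have e : 1 / q * p = p - 1 := by
      have := hpq.symm.inv_add_inv_eq_one
      rw [one_div, eq_sub_of_add_eq this]
      field_simp
    calc W x * (∫⁻ y, K x y * f y ∂μ) ^ p
        ≤ W x * ((∫⁻ y, K x y * H y ∂μ) ^ (1 / q) *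
          (∫⁻ y, K x y * (H y ^ (-(p - 1)) * f y ^ p) ∂μ) ^ (1 / p)) ^ p := by gcongr
      _ = W x * ((∫⁻ y, K x y * H y ∂μ) ^ (p - 1) *
          ∫⁻ y, K x y * (H y ^ (-(p - 1)) * f y ^ p) ∂μ) := by
        rw [ENNReal.mul_rpow_of_nonneg _ _ hp.le, ← ENNReal.rpow_mul, ← ENNReal.rpow_mul, e,
          one_div_mul_cancel hp.ne', ENNReal.rpow_one]
      _ ≤ W x * ((C₁ * H x) ^ (p - 1) *
          ∫⁻ y, K x y * (H y ^ (-(p - 1)) * f y ^ p) ∂μ) := by gcongr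
      _ = _ := by
        rw [ENNReal.mul_rpow_of_nonneg _ _ hp1]
        ring
  have hjoint : AEMeasurable (Function.uncurry fun x y =>
      (H x ^ (p - 1) * W x) * (K x y * (H y ^ (-(p - 1)) * f y ^ p))) (μ.prod μ) :=
    (hHW.comp measurable_fst).aemeasurable.mul (hK.aemeasurable.mul hHf.comp_snd)
  have hC : ∫⁻ x, C₁ ^ (p - 1) * ∫⁻ y, (H x ^ (p - 1) * W x) *
      (K x y * (H y ^ (-(p - 1)) * f y ^ p)) ∂μ ∂μ =
      C₁ ^ (p - 1) * ∫⁻ x, ∫⁻ y, (H x ^ (p - 1) * W x) *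
      (K x y * (H y ^ (-(p - 1)) * f y ^ p)) ∂μ ∂μ :=
    lintegral_const_mul'' _ hjoint.lintegral_prod_right'
  refine (lintegral_mono_ae hstep).trans ?_
  -- After Tonelli the inner integral runs over the output variable `x`, where `h₂` applies.
  rw [hC, lintegral_lintegral_swap hjoint, mul_assoc]
  gcongr
  have hin : ∀ᵐ y ∂μ, ∫⁻ x, (H x ^ (p - 1) * W x) * (K x y * (H y ^ (-(p - 1)) * f y ^ p)) ∂μ ≤
      C₂ * (W y * f y ^ p) := by
    filter_upwards [h₂, hH0, hHt] with y hy h0 ht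
    have e1 : ∀ x, (H x ^ (p - 1) * W x) * (K x y * (H y ^ (-(p - 1)) * f y ^ p)) =
        K x y * (H x ^ (p - 1) * W x) * (H y ^ (-(p - 1)) * f y ^ p) := fun x => by ring
    have e2 : H y ^ (p - 1) * H y ^ (-(p - 1)) = 1 := by
      rw [← ENNReal.rpow_add _ _ h0 ht, add_neg_cancel, ENNReal.rpow_zero]
    simp_rw [e1]
    rw [lintegral_mul_const _ ((hKy y).fun_mul hHW)]
    calc _ ≤ C₂ * (H y ^ (p - 1) * W y) * (H y ^ (-(p - 1)) * f y ^ p) := by gcongr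
      _ = C₂ * ((H y ^ (p - 1) * H y ^ (-(p - 1))) * (W y * f y ^ p)) := by ring
      _ = _ := by rw [e2, one_mul]
  refine (lintegral_mono_ae hin).trans (le_of_eq ?_)
  exact lintegral_const_mul'' _ (hW.aemeasurable.mul (hf.pow_const _))

theorem measurable_bergman_abs :
    Measurable (Function.uncurry fun w η : ℂ => ENNReal.ofReal (‖1 - w * conj η‖ ^ 2)⁻¹) := by
  have h : Measurable fun z : ℂ × ℂ => conj z.2 :=
    Complex.continuous_conj.measurable.comp measurable_snd
  unfold Function.uncurry
  fun_prop

/-! ### Choice of exponents and the uniform weighted bound. -/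

/-- Exponents and constant for which `(1 - |η|)^(-σ) |η - a|^(-τ)` is a Schur test function for
the weight `|η - a|²` on `L^p`. -/
theorem exists_schur_exponents {p : ℝ} (hp : 2 < p) :
    ∃ σ τ C : ℝ, 0 < σ ∧ σ * (p - 1) < 1 ∧ τ * (p - 1) = 2 ∧ 0 ≤ C ∧
      ∀ w ∈ unitDisk, ∀ a : ℂ, w ≠ a → ∫⁻ η in unitDisk, ENNReal.ofReal
        ((‖1 - w * conj η‖ ^ 2)⁻¹ * ((1 - ‖η‖) ^ (-σ) * ‖η - a‖ ^ (-τ))) ≤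
      ENNReal.ofReal (C * ((1 - ‖w‖) ^ (-σ) * ‖w - a‖ ^ (-τ))) := by
  have hp1 : 0 < p - 1 := by linarith
  obtain ⟨τ, hτdef⟩ : ∃ τ, τ = 2 / (p - 1) := ⟨_, rfl⟩
  have hτ : 0 < τ := by rw [hτdef]; positivity
  have hτ2 : τ < 2 := by rw [hτdef, div_lt_iff₀ hp1]; linarith
  have hτp : τ * (p - 1) = 2 := by rw [hτdef, div_mul_cancel₀ _ hp1.ne']
  -- `t = 1 + τ/2` is the midpoint of `τ` and `2`: above `τ` so that `t/τ > 1` is a Young exponent,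
  -- below `2` for local integrability.
  have ht : 1 + τ / 2 < 2 := by linarith
  obtain ⟨q, hq⟩ : ∃ q, ((1 + τ / 2) / τ).HolderConjugate q :=
    ⟨_, Real.HolderConjugate.conjExponent (by rw [lt_div_iff₀ hτ]; linarith)⟩
  have hq0 : 0 < q := hq.symm.pos
  have hden : 0 < 1 + q + p := by linarith
  -- Small enough for `σ`, `σq` and `σ(p - 1)` to be below `1` at once.
  obtain ⟨σ, hσdef⟩ : ∃ σ, σ = 1 / (1 + q + p) := ⟨_, rfl⟩
  have hσ : 0 < σ := by rw [hσdef]; positivity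
  have hσ1 : σ < 1 := by rw [hσdef, div_lt_iff₀ hden]; linarith
  have hσq : σ * q < 1 := by rw [hσdef, div_mul_eq_mul_div, div_lt_iff₀ hden]; linarith
  have hσp : σ * (p - 1) < 1 := by rw [hσdef, div_mul_eq_mul_div, div_lt_iff₀ hden]; linarith
  obtain ⟨C, hC, hS⟩ := lintegral_schur_weight_le hτ ht hq hσ hσ1 hσq
  exact ⟨σ, τ, C, hσ, hσp, hτp, hC, hS⟩

/-- The relation `τ(p - 1) = 2` makes the singularity of the test function cancel the zero of the
weight, so only a power of the boundary distance survives. -/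
theorem schur_weight_rpow_mul {p σ τ : ℝ} (hp1 : 0 < p - 1) (hτp : τ * (p - 1) = 2) {x y : ℝ}
    (hx : 0 < x) (hy : 0 < y) :
    ENNReal.ofReal (x ^ (-σ) * y ^ (-τ)) ^ (p - 1) * ENNReal.ofReal (y ^ 2) =
      ENNReal.ofReal (x ^ (-(σ * (p - 1)))) := by
  rw [ENNReal.ofReal_rpow_of_nonneg (by positivity) hp1.le,
    ← ENNReal.ofReal_mul (by positivity), Real.mul_rpow (by positivity) (by positivity),
    ← Real.rpow_mul hx.le, ← Real.rpow_mul hy.le, neg_mul, neg_mul, hτp, mul_assoc,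
    Real.rpow_neg hy.le, Real.rpow_two, inv_mul_cancel₀ (by positivity), mul_one]

theorem ae_mem_unitDisk_and_ne (a : ℂ) :
    ∀ᵐ η ∂volume.restrict unitDisk, η ∈ unitDisk ∧ 0 < 1 - ‖η‖ ∧ 0 < ‖η - a‖ := by
  filter_upwards [ae_restrict_mem (s := unitDisk) Metric.isOpen_ball.measurableSet,
    ae_restrict_of_ae (Measure.ae_ne volume a)] with η h1 h2
  exact ⟨h1, by linarith [mem_ball_zero_iff.1 h1], norm_pos_iff.2 (sub_ne_zero.2 h2)⟩

theorem norm_one_sub_mul_conj_comm (w η : ℂ) : ‖1 - w * conj η‖ = ‖1 - η * conj w‖ := by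
  rw [← RCLike.norm_conj (1 - w * conj η)]
  simp [mul_comm]

/-- Weighted `L^p` bound for the positive Bergman operator with weight `|w - a|²`, uniformly
in `a`. -/
theorem bergman_abs_weighted_bound {p : ℝ} (hp : 2 < p) :
    ∃ C : ℝ, 0 ≤ C ∧ ∀ a : ℂ, ∀ f : ℂ → ℝ≥0∞, AEMeasurable f (volume.restrict unitDisk) →
      ∫⁻ w in unitDisk, ENNReal.ofReal (‖w - a‖ ^ 2) *
          (∫⁻ η in unitDisk, ENNReal.ofReal (‖1 - w * conj η‖ ^ 2)⁻¹ * f η) ^ p ≤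
        ENNReal.ofReal C * ∫⁻ η in unitDisk, ENNReal.ofReal (‖η - a‖ ^ 2) * f η ^ p := by
  have hp1 : 0 < p - 1 := by linarith
  obtain ⟨σ, τ, C₁, hσ, hσp, hτp, hC₁, hS⟩ := exists_schur_exponents hp
  have hσp0 : 0 < σ * (p - 1) := by positivity
  obtain ⟨C₂, hC₂def⟩ : ∃ C₂, C₂ = 2 * Real.pi * (1 / (1 - σ * (p - 1)) + 1 / (σ * (p - 1))) :=
    ⟨_, rfl⟩
  have hC₂ : 0 ≤ C₂ := by
    have : 0 < 1 - σ * (p - 1) := by linarith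
    have hpi := Real.pi_pos
    rw [hC₂def]
    positivity
  refine ⟨C₁ ^ (p - 1) * C₂, by positivity, fun a f hf => ?_⟩
  have hne := ae_mem_unitDisk_and_ne a
  have hH : Measurable fun η : ℂ => ENNReal.ofReal ((1 - ‖η‖) ^ (-σ) * ‖η - a‖ ^ (-τ)) := by
    fun_prop
  have hW : Measurable fun η : ℂ => ENNReal.ofReal (‖η - a‖ ^ 2) := by fun_prop
  have h := schur_test (μ := volume.restrict unitDisk)
    (Real.HolderConjugate.conjExponent (by linarith : 1 < p)) measurable_bergman_abs hH hW hf
    (hne.mono fun η hη => (ENNReal.ofReal_pos.2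
      (mul_pos (Real.rpow_pos_of_pos hη.2.1 _) (Real.rpow_pos_of_pos hη.2.2 _))).ne')
    (Filter.Eventually.of_forall fun η => ENNReal.ofReal_ne_top)
    (C₁ := ENNReal.ofReal C₁) (C₂ := ENNReal.ofReal C₂) ?_ ?_
  · rwa [ENNReal.ofReal_rpow_of_nonneg hC₁ hp1.le, ← ENNReal.ofReal_mul (by positivity)] at h
  · filter_upwards [hne] with w hw
    have h := hS w hw.1 a (sub_ne_zero.1 (norm_pos_iff.1 hw.2.2))
    rw [ENNReal.ofReal_mul hC₁] at h
    refine le_trans (le_of_eq (lintegral_congr fun η => ?_)) h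
    rw [← ENNReal.ofReal_mul (by positivity)]
  -- The second condition integrates in `w`; the modulus of the kernel is symmetric, so
  -- Forelli–Rudin applies with the roles exchanged.
  · filter_upwards [hne] with η hη
    rw [schur_weight_rpow_mul hp1 hτp hη.2.1 hη.2.2, ← ENNReal.ofReal_mul hC₂, hC₂def]
    refine le_trans (le_of_eq (lintegral_congr_ae ?_))
      (forelli_rudin hσp0 hσp (mem_ball_zero_iff.1 hη.1))
    filter_upwards [hne] with w hw
    rw [schur_weight_rpow_mul hp1 hτp hw.2.1 hw.2.2, norm_one_sub_mul_conj_comm w η,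
      ← ENNReal.ofReal_mul (by positivity)]

/-! ### Absolute convergence at every point. -/

/-- The integral of a Schur test function against the kernel is finite at every point. -/
theorem lintegral_bergman_abs_mul_ne_top {H : ℂ → ℝ≥0∞} {w₀ : ℂ} (hw₀ : w₀ ∈ unitDisk)
    (h : ∫⁻ η in unitDisk, ENNReal.ofReal (‖1 - w₀ * conj η‖ ^ 2)⁻¹ * H η ≠ ∞) {w : ℂ}
    (hw : w ∈ unitDisk) :
    ∫⁻ η in unitDisk, ENNReal.ofReal (‖1 - w * conj η‖ ^ 2)⁻¹ * H η ≠ ∞ := by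
  have hw1 : 0 < 1 - ‖w‖ := by linarith [mem_ball_zero_iff.1 hw]
  -- The kernel at `w` is at most `(1 - |w|)⁻²`, and the kernel at `w₀` is at least `1/4`, so the
  -- former is dominated by a multiple of the latter.
  refine ne_top_of_le_ne_top (ENNReal.mul_ne_top
    (ENNReal.ofReal_ne_top (r := ((1 - ‖w‖) ^ 2)⁻¹ * 4)) h) ?_
  rw [← lintegral_const_mul' _ _ ENNReal.ofReal_ne_top]
  refine setLIntegral_mono' Metric.isOpen_ball.measurableSet fun η hη => ?_
  rw [← mul_assoc, ← ENNReal.ofReal_mul (by positivity)]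
  refine mul_le_mul_left (ENNReal.ofReal_le_ofReal ?_) _
  have hη' : ‖η‖ < 1 := mem_ball_zero_iff.1 hη
  have hw₀' : ‖w₀‖ < 1 := mem_ball_zero_iff.1 hw₀
  have h1 := norm_one_sub_mul_conj_ge w η hη'.le
  have h2 : ‖1 - w₀ * conj η‖ ≤ 2 := by
    refine (norm_sub_le _ _).trans ?_
    rw [norm_one, norm_mul, RCLike.norm_conj]
    nlinarith [norm_nonneg w₀, norm_nonneg η]
  have h3 : 0 < ‖1 - w₀ * conj η‖ := norm_pos_iff.2 (one_sub_mul_conj_ne_zero hw₀' hη'.le)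
  have h4 : 1 ≤ 4 * (‖1 - w₀ * conj η‖ ^ 2)⁻¹ := by
    rw [← div_eq_mul_inv, le_div_iff₀ (by positivity)]
    nlinarith
  calc (‖1 - w * conj η‖ ^ 2)⁻¹ ≤ ((1 - ‖w‖) ^ 2)⁻¹ * 1 := by rw [mul_one]; gcongr
    _ ≤ ((1 - ‖w‖) ^ 2)⁻¹ * (4 * (‖1 - w₀ * conj η‖ ^ 2)⁻¹) := by gcongr
    _ = _ := by ring

theorem rpow_neg_le_of_one_le_rpow_mul {H W : ℝ≥0∞} {s : ℝ} (h0 : H ≠ 0) (ht : H ≠ ∞)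
    (h : 1 ≤ H ^ s * W) : H ^ (-s) ≤ W :=
  calc H ^ (-s) = H ^ (-s) * 1 := (mul_one _).symm
    _ ≤ H ^ (-s) * (H ^ s * W) := by gcongr
    _ = W := by
      rw [← mul_assoc, ← ENNReal.rpow_add _ _ h0 ht, neg_add_cancel, ENNReal.rpow_zero, one_mul]

theorem exists_mem_unitDisk_ne (a : ℂ) : ∃ w ∈ unitDisk, w ≠ a := by
  have h2 : ‖(2 : ℂ)⁻¹‖ < 1 := by
    rw [norm_inv, Complex.norm_ofNat]
    norm_num
  rcases eq_or_ne 0 a with rfl | h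
  · exact ⟨2⁻¹, mem_ball_zero_iff.2 h2, inv_ne_zero two_ne_zero⟩
  · exact ⟨0, Metric.mem_ball_self one_pos, h⟩

/-- The positive Bergman integral of a function in the weighted `L^p` space is finite at every
point of the disk. -/
theorem bergman_abs_ne_top {p : ℝ} (hp : 2 < p) {a : ℂ} {f : ℂ → ℝ≥0∞}
    (hf : AEMeasurable f (volume.restrict unitDisk))
    (hft : ∫⁻ η in unitDisk, ENNReal.ofReal (‖η - a‖ ^ 2) * f η ^ p ≠ ∞) {w : ℂ}
    (hw : w ∈ unitDisk) :
    ∫⁻ η in unitDisk, ENNReal.ofReal (‖1 - w * conj η‖ ^ 2)⁻¹ * f η ≠ ∞ := by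
  have hp1 : 0 < p - 1 := by linarith
  obtain ⟨σ, τ, C₁, hσ, hσp, hτp, hC₁, hS⟩ := exists_schur_exponents hp
  have hpq := Real.HolderConjugate.conjExponent (by linarith : 1 < p)
  have hne := ae_mem_unitDisk_and_ne a
  have hw1 : 0 < 1 - ‖w‖ := by linarith [mem_ball_zero_iff.1 hw]
  have hH : Measurable fun η : ℂ => ENNReal.ofReal ((1 - ‖η‖) ^ (-σ) * ‖η - a‖ ^ (-τ)) := by
    fun_prop
  have hH0 : ∀ᵐ η ∂volume.restrict unitDisk,
      ENNReal.ofReal ((1 - ‖η‖) ^ (-σ) * ‖η - a‖ ^ (-τ)) ≠ 0 :=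
    hne.mono fun η hη => (ENNReal.ofReal_pos.2
      (mul_pos (Real.rpow_pos_of_pos hη.2.1 _) (Real.rpow_pos_of_pos hη.2.2 _))).ne'
  have hK : Measurable fun η : ℂ => ENNReal.ofReal (‖1 - w * conj η‖ ^ 2)⁻¹ :=
    (measurable_conj_norm w).ennreal_ofReal
  -- The Schur bound is unavailable at `w = a`, so finiteness is taken from another point and
  -- transferred.
  obtain ⟨w₀, hw₀, hw₀a⟩ := exists_mem_unitDisk_ne a
  have hA := lintegral_bergman_abs_mul_ne_top
    (H := fun η => ENNReal.ofReal ((1 - ‖η‖) ^ (-σ) * ‖η - a‖ ^ (-τ))) hw₀ (by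
      refine ne_top_of_le_ne_top ENNReal.ofReal_ne_top
        (le_trans (le_of_eq (lintegral_congr fun η => ?_)) (hS w₀ hw₀ a hw₀a))
      rw [← ENNReal.ofReal_mul (by positivity)]) hw
  have hB : ∫⁻ η in unitDisk, ENNReal.ofReal (‖1 - w * conj η‖ ^ 2)⁻¹ *
      (ENNReal.ofReal ((1 - ‖η‖) ^ (-σ) * ‖η - a‖ ^ (-τ)) ^ (-(p - 1)) * f η ^ p) ≠ ∞ := by
    refine ne_top_of_le_ne_top (ENNReal.mul_ne_top
      (ENNReal.ofReal_ne_top (r := ((1 - ‖w‖) ^ 2)⁻¹)) hft) ?_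
    rw [← lintegral_const_mul' _ _ ENNReal.ofReal_ne_top]
    refine lintegral_mono_ae ?_
    filter_upwards [hne, hH0] with η hη h0
    -- Since `H^(p-1) |η - a|²` is a nonpositive power of `1 - |η| ≤ 1`, it is at least `1`; so
    -- `H^(-(p-1))` is dominated by the weight.
    have hle : ENNReal.ofReal ((1 - ‖η‖) ^ (-σ) * ‖η - a‖ ^ (-τ)) ^ (-(p - 1)) ≤
        ENNReal.ofReal (‖η - a‖ ^ 2) := by
      have h3 : 1 ≤ ENNReal.ofReal ((1 - ‖η‖) ^ (-σ) * ‖η - a‖ ^ (-τ)) ^ (p - 1) *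
          ENNReal.ofReal (‖η - a‖ ^ 2) := by
        rw [schur_weight_rpow_mul hp1 hτp hη.2.1 hη.2.2, ENNReal.one_le_ofReal]
        exact Real.one_le_rpow_of_pos_of_le_one_of_nonpos hη.2.1 (by linarith [norm_nonneg η])
          (neg_nonpos.2 (by positivity))
      exact rpow_neg_le_of_one_le_rpow_mul h0 ENNReal.ofReal_ne_top h3
    have hKle : ENNReal.ofReal (‖1 - w * conj η‖ ^ 2)⁻¹ ≤ ENNReal.ofReal ((1 - ‖w‖) ^ 2)⁻¹ := by
      have := norm_one_sub_mul_conj_ge w η (mem_ball_zero_iff.1 hη.1).le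
      gcongr
    exact mul_le_mul' hKle (mul_le_mul_left hle _)
  refine ne_top_of_le_ne_top ?_ (lintegral_mul_le_schur hpq hK.aemeasurable hH.aemeasurable
    hf hH0 (Filter.Eventually.of_forall fun η => ENNReal.ofReal_ne_top))
  exact ENNReal.mul_ne_top (ENNReal.rpow_ne_top_of_nonneg (one_div_nonneg.2 hpq.symm.nonneg) hA)
    (ENNReal.rpow_ne_top_of_nonneg (one_div_nonneg.2 hpq.nonneg) hB)

/-! ### The operator on the weighted `L^p` space. -/

theorem weightedDiskMeasure_absolutelyContinuous (a : ℂ) :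
    weightedDiskMeasure a ≪ volume.restrict unitDisk :=
  withDensity_absolutelyContinuous _ _

/-- The density vanishes only at `a`, a null set. Hence the integral over the disk does not depend
on the representative of a class for the weighted measure. -/
theorem absolutelyContinuous_weightedDiskMeasure (a : ℂ) :
    volume.restrict unitDisk ≪ weightedDiskMeasure a := by
  refine withDensity_absolutelyContinuous' (by fun_prop) ?_
  filter_upwards [ae_mem_unitDisk_and_ne a] with η hη
  have := hη.2.2
  exact (ENNReal.ofReal_pos.2 (by positivity)).ne'

theorem lintegral_weightedDiskMeasure (a : ℂ) (g : ℂ → ℝ≥0∞) :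
    ∫⁻ η, g η ∂weightedDiskMeasure a =
      ∫⁻ η in unitDisk, ENNReal.ofReal (‖η - a‖ ^ 2) * g η :=
  lintegral_withDensity_eq_lintegral_mul_non_measurable₀ _ (by fun_prop)
    (Filter.Eventually.of_forall fun _ => ENNReal.ofReal_lt_top) g

/-- The positive Bergman operator of the disk, with its kernel written out. -/
noncomputable def diskPositiveBergman (f : ℂ → ℂ) (w : ℂ) : ℂ :=
  ∫ η in unitDisk, ((Real.pi⁻¹ * (‖1 - w * conj η‖ ^ 2)⁻¹ : ℝ) : ℂ) * f η

/-- The chosen kernel is identified only up to a null set in `η` for each `w`; replacing it by the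
explicit one supplies joint measurability and leaves the integral unchanged. -/
theorem positiveBergman_unitDisk (f : ℂ → ℂ) {w : ℂ} (hw : w ∈ unitDisk) :
    positiveBergman unitDisk f w = diskPositiveBergman f w := by
  refine integral_congr_ae ?_
  filter_upwards [norm_bergmanKernel_unitDisk_ae hw] with η hη
  rw [hη]

theorem diskPositiveBergman_congr {f g : ℂ → ℂ} (h : f =ᵐ[volume.restrict unitDisk] g) (w : ℂ) :
    diskPositiveBergman f w = diskPositiveBergman g w := by
  refine integral_congr_ae ?_
  filter_upwards [h] with η hη
  rw [hη]

theorem measurable_bergman_abs_real :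
    Measurable fun z : ℂ × ℂ => ((Real.pi⁻¹ * (‖1 - z.1 * conj z.2‖ ^ 2)⁻¹ : ℝ) : ℂ) := by
  have h : Measurable fun z : ℂ × ℂ => conj z.2 :=
    Complex.continuous_conj.measurable.comp measurable_snd
  fun_prop

theorem aestronglyMeasurable_diskPositiveBergman {f : ℂ → ℂ}
    (hf : AEStronglyMeasurable f (volume.restrict unitDisk)) :
    AEStronglyMeasurable (diskPositiveBergman f) (volume.restrict unitDisk) :=
  AEStronglyMeasurable.integral_prod_right'
    (f := fun z : ℂ × ℂ => ((Real.pi⁻¹ * (‖1 - z.1 * conj z.2‖ ^ 2)⁻¹ : ℝ) : ℂ) * f z.2)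
    (measurable_bergman_abs_real.aestronglyMeasurable.mul hf.comp_snd)

theorem enorm_bergman_abs_mul_le (w η z : ℂ) :
    ‖((Real.pi⁻¹ * (‖1 - w * conj η‖ ^ 2)⁻¹ : ℝ) : ℂ) * z‖ₑ ≤
      ENNReal.ofReal (‖1 - w * conj η‖ ^ 2)⁻¹ * ‖z‖ₑ := by
  have hpi : Real.pi⁻¹ ≤ 1 := inv_le_one_of_one_le₀ (by linarith [Real.pi_gt_three])
  have hpi0 := Real.pi_pos
  rw [enorm_mul]
  gcongr
  rw [← ofReal_norm, Complex.norm_real, Real.norm_of_nonneg (by positivity)]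
  exact ENNReal.ofReal_le_ofReal (mul_le_of_le_one_left (by positivity) hpi)

theorem MeasureTheory.MemLp.aestronglyMeasurable_unitDisk {p : ℝ≥0∞} {a : ℂ} {f : ℂ → ℂ}
    (hf : MemLp f p (weightedDiskMeasure a)) :
    AEStronglyMeasurable f (volume.restrict unitDisk) :=
  hf.1.mono_ac (absolutelyContinuous_weightedDiskMeasure a)

theorem eLpNorm_weightedDiskMeasure {p : ℝ≥0∞} (hp : p ≠ 0) (hp' : p ≠ ∞) (a : ℂ) (f : ℂ → ℂ) :
    eLpNorm f p (weightedDiskMeasure a) =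
      (∫⁻ η in unitDisk, ENNReal.ofReal (‖η - a‖ ^ 2) * ‖f η‖ₑ ^ p.toReal) ^ (1 / p.toReal) := by
  rw [eLpNorm_eq_lintegral_rpow_enorm_toReal hp hp', lintegral_weightedDiskMeasure]

theorem integrableOn_diskPositiveBergman {p : ℝ≥0∞} (hp : 2 < p) (hp' : p < ∞) {a : ℂ}
    {f : ℂ → ℂ} (hf : MemLp f p (weightedDiskMeasure a)) {w : ℂ} (hw : w ∈ unitDisk) :
    IntegrableOn (fun η => ((Real.pi⁻¹ * (‖1 - w * conj η‖ ^ 2)⁻¹ : ℝ) : ℂ) * f η) unitDisk := by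
  have hp0 : p ≠ 0 := (zero_le_two.trans_lt hp).ne'
  have hP : 2 < p.toReal := by simpa using (ENNReal.toReal_lt_toReal (by simp) hp'.ne).2 hp
  have hm := hf.aestronglyMeasurable_unitDisk
  have hk : Measurable fun η : ℂ => ((Real.pi⁻¹ * (‖1 - w * conj η‖ ^ 2)⁻¹ : ℝ) : ℂ) :=
    Complex.measurable_ofReal.comp ((measurable_conj_norm w).const_mul _)
  have hft := hf.2
  rw [eLpNorm_weightedDiskMeasure hp0 hp'.ne,
    ENNReal.rpow_lt_top_iff_of_pos (one_div_pos.2 (by linarith))] at hft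
  refine ⟨hk.aestronglyMeasurable.mul hm, ?_⟩
  refine (lintegral_mono fun η => enorm_bergman_abs_mul_le w η (f η)).trans_lt ?_
  exact (bergman_abs_ne_top hP hm.enorm hft.ne hw).lt_top

theorem eLpNorm_diskPositiveBergman_le {p : ℝ≥0∞} (hp : 2 < p) (hp' : p < ∞) :
    ∃ C : ℝ, 0 ≤ C ∧ ∀ a : ℂ, ∀ f : ℂ → ℂ, MemLp f p (weightedDiskMeasure a) →
      eLpNorm (diskPositiveBergman f) p (weightedDiskMeasure a) ≤
        ENNReal.ofReal C * eLpNorm f p (weightedDiskMeasure a) := by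
  have hp0 : p ≠ 0 := (zero_le_two.trans_lt hp).ne'
  have hP : 2 < p.toReal := by simpa using (ENNReal.toReal_lt_toReal (by simp) hp'.ne).2 hp
  have hinv : 0 ≤ 1 / p.toReal := one_div_nonneg.2 (by linarith)
  obtain ⟨C, hC, h⟩ := bergman_abs_weighted_bound hP
  refine ⟨C ^ (1 / p.toReal), by positivity, fun a f hf => ?_⟩
  rw [eLpNorm_weightedDiskMeasure hp0 hp'.ne, eLpNorm_weightedDiskMeasure hp0 hp'.ne,
    ← ENNReal.ofReal_rpow_of_nonneg hC hinv, ← ENNReal.mul_rpow_of_nonneg _ _ hinv]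
  refine ENNReal.rpow_le_rpow (le_trans (lintegral_mono fun w => ?_)
    (h a (fun η => ‖f η‖ₑ) hf.aestronglyMeasurable_unitDisk.enorm)) hinv
  refine mul_le_mul_right (ENNReal.rpow_le_rpow ?_ (by linarith)) _
  exact (enorm_integral_le_lintegral_enorm _).trans
    (lintegral_mono fun η => enorm_bergman_abs_mul_le w η (f η))

theorem diskPositiveBergman_add {f g : ℂ → ℂ} {w : ℂ}
    (hf : IntegrableOn (fun η => ((Real.pi⁻¹ * (‖1 - w * conj η‖ ^ 2)⁻¹ : ℝ) : ℂ) * f η) unitDisk)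
    (hg : IntegrableOn (fun η => ((Real.pi⁻¹ * (‖1 - w * conj η‖ ^ 2)⁻¹ : ℝ) : ℂ) * g η) unitDisk) :
    diskPositiveBergman (f + g) w = diskPositiveBergman f w + diskPositiveBergman g w := by
  simp only [diskPositiveBergman, Pi.add_apply, mul_add]
  exact integral_add hf hg

theorem diskPositiveBergman_smul (c : ℂ) (f : ℂ → ℂ) (w : ℂ) :
    diskPositiveBergman (c • f) w = c * diskPositiveBergman f w := by
  simp only [diskPositiveBergman, Pi.smul_apply, smul_eq_mul, mul_left_comm _ c]
  exact integral_const_mul _ _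

theorem ae_mem_unitDisk (a : ℂ) : ∀ᵐ w ∂weightedDiskMeasure a, w ∈ unitDisk :=
  (weightedDiskMeasure_absolutelyContinuous a).ae_le
    (ae_restrict_mem Metric.isOpen_ball.measurableSet)

theorem memLp_diskPositiveBergman {p : ℝ≥0∞} (hp : 2 < p) (hp' : p < ∞) {a : ℂ} {f : ℂ → ℂ}
    (hf : MemLp f p (weightedDiskMeasure a)) :
    MemLp (diskPositiveBergman f) p (weightedDiskMeasure a) := by
  obtain ⟨C, -, h⟩ := eLpNorm_diskPositiveBergman_le hp hp'
  exact ⟨(aestronglyMeasurable_diskPositiveBergman hf.aestronglyMeasurable_unitDisk).mono_ac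
      (weightedDiskMeasure_absolutelyContinuous a),
    (h a f hf).trans_lt (ENNReal.mul_lt_top ENNReal.ofReal_lt_top hf.2)⟩

/-- The positive Bergman operator as a linear map on the weighted `L^p` space. -/
noncomputable def diskPositiveBergmanLp {p : ℝ≥0∞} (hp : 2 < p) (hp' : p < ∞) (a : ℂ) :
    Lp ℂ p (weightedDiskMeasure a) →ₗ[ℂ] Lp ℂ p (weightedDiskMeasure a) where
  toFun f := (memLp_diskPositiveBergman hp hp' (Lp.memLp f)).toLp (diskPositiveBergman f)
  map_add' f g := by
    rw [← MemLp.toLp_add]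
    refine MemLp.toLp_congr _ _ ?_
    filter_upwards [ae_mem_unitDisk a] with w hw
    rw [Pi.add_apply, ← diskPositiveBergman_add
      (integrableOn_diskPositiveBergman hp hp' (Lp.memLp f) hw)
      (integrableOn_diskPositiveBergman hp hp' (Lp.memLp g) hw)]
    exact diskPositiveBergman_congr
      ((absolutelyContinuous_weightedDiskMeasure a).ae_le (Lp.coeFn_add f g)) w
  map_smul' c f := by
    rw [RingHom.id_apply, ← MemLp.toLp_const_smul]
    refine MemLp.toLp_congr _ _ (Filter.Eventually.of_forall fun w => ?_)
    rw [Pi.smul_apply, smul_eq_mul, ← diskPositiveBergman_smul]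
    exact diskPositiveBergman_congr
      ((absolutelyContinuous_weightedDiskMeasure a).ae_le (Lp.coeFn_smul c f)) w

theorem proposition1p2 (p : ℝ≥0∞) [Fact (1 ≤ p)] (hp : 2 < p) (hp' : p < ∞) :
    ∃ C : ℝ, ∀ w₂ ∈ unitDisk,
      ∃ T : Lp ℂ p (weightedDiskMeasure w₂) →L[ℂ] Lp ℂ p (weightedDiskMeasure w₂),
        (∀ (f : ℂ → ℂ) (hf : MemLp f p (weightedDiskMeasure w₂)),
          (∀ w ∈ unitDisk,
            IntegrableOn (fun η => (‖bergmanKernel unitDisk w η‖ : ℂ) * f η) unitDisk) ∧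
          T (hf.toLp f) =ᵐ[weightedDiskMeasure w₂] positiveBergman unitDisk f) ∧
        ‖T‖ ≤ C := by
  obtain ⟨C, hC, hbound⟩ := eLpNorm_diskPositiveBergman_le hp hp'
  refine ⟨C, fun a _ => ⟨(diskPositiveBergmanLp hp hp' a).mkContinuous C fun f => ?_,
    fun f hf => ⟨fun w hw => ?_, ?_⟩, LinearMap.mkContinuous_norm_le _ hC _⟩⟩
  · have h := hbound a f (Lp.memLp f)
    rw [diskPositiveBergmanLp, LinearMap.coe_mk, AddHom.coe_mk, Lp.norm_toLp, Lp.norm_def]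
    have h2 := ENNReal.toReal_mono
      (ENNReal.mul_ne_top ENNReal.ofReal_ne_top (Lp.memLp f).2.ne) h
    rwa [ENNReal.toReal_mul, ENNReal.toReal_ofReal hC] at h2
  · refine (integrableOn_diskPositiveBergman hp hp' hf hw).congr ?_
    filter_upwards [norm_bergmanKernel_unitDisk_ae hw] with η hη
    rw [hη]
  · have h1 : (diskPositiveBergmanLp hp hp' a (hf.toLp f) : ℂ → ℂ) =ᵐ[weightedDiskMeasure a]
        diskPositiveBergman (hf.toLp f) :=
      MemLp.coeFn_toLp (memLp_diskPositiveBergman hp hp' (Lp.memLp _))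
    rw [LinearMap.mkContinuous_apply]
    filter_upwards [h1, ae_mem_unitDisk a] with w hw hwD
    rw [hw, positiveBergman_unitDisk f hwD]
    exact diskPositiveBergman_congr
      ((absolutelyContinuous_weightedDiskMeasure a).ae_le hf.coeFn_toLp) w
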